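/- Let $\Lambda$ be a cyclic Nakayama algebra with $n\ge 1$ isomorphism classes of simple modules. That is, $\Lambda$ is a basic connected artin algebra (an algebra finitely generated as a module over a commutative artinian ring) such that all indecomposable projective and all indecomposable injective finitely generated left $\Lambda$-modules are uniserial, and whose ordinary quiver is a complete oriented cycle. This means that the simple left $\Lambda$-modules can be labelled, up to isomorphism and without repetition, as $S_i$ with $i\in\mathbb Z_n=\mathbb Z/n\mathbb Z$, in such a way that there is an arrow from the vertex $i$ to the vertex $j$ (i.e. $\operatorname{Ext}^1_\Lambda(S_i,S_j)\neq 0$) if and only if $i=j+1$. Fix such a labelling, let $P_i$ be the projective cover of $S_i$, and let $c_i$ be the length of $P_i$; the function $c:\mathbb Z_n\to\mathbb Z$, $i\mapsto c_i$, is called the admissible sequence of $\Lambda$. Put $$\mathcal Q_c=\{i\in\mathbb Z_n \mid c_{i+1}\le c_i\},\qquad \mathcal P_c=\{i\in\mathbb Z_n\mid c_{i+1}=c_i+1\}.$$ The dominant dimension $\operatorname{dom.dim}\Lambda$ is the supremum of all $k$ such that the first $k$ terms $I_0,\dots,I_{k-1}$ of a minimal injective resolution $0\to\Lambda\to I_0\to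 I_1\to\cdots$ of the left module $\Lambda$ are projective. Let $\widetilde Q$ be the direct sum of representatives of the isomorphism classes of all indecomposable projective-injective $\Lambda$-modules, and let $\mathcal C_\Lambda$ be the full subcategory of finitely generated left $\Lambda$-modules that are both a quotient of a finite direct sum of copies of $\widetilde Q$ and a submodule of a finite direct sum of copies of $\widetilde Q$. A tilting module is a basic finitely generated left module $T$ (a finite direct sum of pairwise non-isomorphic indecomposable modules) with projective dimension at most $1$, with $\operatorname{Ext}^1_\Lambda(T,T)=0$, and for which there is an exact sequence $0\to\Lambda\to T_0\to T_1\to0$ such that $T_0,T_1$ are direct summands of finite direct sums of copies of $T$. Then $$\operatorname{dom.dim}\Lambda\ge 2\quad\Longleftrightarrow\quad \mathcal P_c\subseteq\{\,j-c_j\in\mathbb Z_n \mid j\in\mathcal Q_c\,\},$$ and moreover $\operatorname{dom.dim}\Lambda\ge2$ if and only if $\mathcal C_\Lambda$ contains a tilting $\Lambda$-module. -/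

import Mathlib

universe u v

open CategoryTheory

namespace NakayamaTilting

section Modules

variable (Λ : Type u) [Ring Λ]

/-- The module `M` is indecomposable. -/
def IsIndecomposable (M : Type u) [AddCommGroup M] [Module Λ M] : Prop :=
  Indecomposable (ModuleCat.of Λ M)

/-- The submodules of `M` are totally ordered by inclusion. -/
def IsUniserial (M : Type u) [AddCommGroup M] [Module Λ M] : Prop :=
  ∀ N N' : Submodule Λ M, N ≤ N' ∨ N' ≤ N

/-- `M` is a finite direct sum of pairwise non-isomorphic indecomposable modules. -/
def IsBasicModule (M : Type u) [AddCommGroup M] [Module Λ M] : Prop :=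
  ∃ (m : ℕ) (N : Fin m → ModuleCat.{u} Λ),
    (∀ i, IsIndecomposable Λ (N i)) ∧
    (∀ i j, Nonempty (N i ≃ₗ[Λ] N j) → i = j) ∧
    Nonempty (M ≃ₗ[Λ] (∀ i, N i))

/-- `M ∈ add T`: `M` is a direct summand of a finite direct sum of copies of `T`. -/
def InAdd (T : Type u) [AddCommGroup T] [Module Λ T]
    (M : Type u) [AddCommGroup M] [Module Λ M] : Prop :=
  ∃ (m : ℕ) (M' : ModuleCat.{u} Λ), Nonempty ((M × M') ≃ₗ[Λ] (Fin m → T))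

/-- `M ∈ Gen X`: `M` is a quotient of a finite direct sum of copies of `X`. -/
def IsGeneratedBy (X : Type u) [AddCommGroup X] [Module Λ X]
    (M : Type u) [AddCommGroup M] [Module Λ M] : Prop :=
  ∃ (m : ℕ) (f : (Fin m → X) →ₗ[Λ] M), Function.Surjective f

/-- `M ∈ Cogen X`: `M` embeds into a finite direct sum of copies of `X`. -/
def IsCogeneratedBy (X : Type u) [AddCommGroup X] [Module Λ X]
    (M : Type u) [AddCommGroup M] [Module Λ M] : Prop :=
  ∃ (m : ℕ) (f : M →ₗ[Λ] (Fin m → X)), Function.Injective f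

/-- `M` is a finitely generated indecomposable module which is projective and injective. -/
structure IsIndecProjInj (M : Type u) [AddCommGroup M] [Module Λ M] : Prop where
  finite : Module.Finite Λ M
  indecomposable : IsIndecomposable Λ M
  projective : Module.Projective Λ M
  injective : Module.Injective Λ M

/-- `Q` is the direct sum of a complete set of representatives of the isomorphism classes of
indecomposable projective-injective modules (this determines `Q` up to isomorphism). -/
def IsProjInjSum (Q : Type u) [AddCommGroup Q] [Module Λ Q] : Prop :=
  ∃ (t : ℕ) (N : Fin t → ModuleCat.{u} Λ),
    (∀ i, IsIndecProjInj Λ (N i)) ∧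
    (∀ i j, Nonempty (N i ≃ₗ[Λ] N j) → i = j) ∧
    (∀ M : ModuleCat.{u} Λ, IsIndecProjInj Λ M → ∃ i, Nonempty (M ≃ₗ[Λ] N i)) ∧
    Nonempty (Q ≃ₗ[Λ] (∀ i, N i))

/-- `M` belongs to the subcategory `C_Λ` of finitely generated modules which are both generated
and cogenerated by the sum of all indecomposable projective-injective modules. -/
def InSubcategoryC (M : Type u) [AddCommGroup M] [Module Λ M] : Prop :=
  Module.Finite Λ M ∧
    ∃ Q : ModuleCat.{u} Λ, IsProjInjSum Λ Q ∧ IsGeneratedBy Λ Q M ∧ IsCogeneratedBy Λ Q M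

/-- (Classical) tilting modules: finitely generated basic modules `T` of projective dimension at
most one, without self-extensions, for which there is an exact sequence `0 → Λ → T₀ → T₁ → 0`
with `T₀, T₁ ∈ add T`. -/
structure IsTilting (T : Type u) [AddCommGroup T] [Module Λ T] : Prop where
  finite : Module.Finite Λ T
  basic : IsBasicModule Λ T
  projDim_le_one : HasProjectiveDimensionLE (ModuleCat.of Λ T) 1
  ext_eq_zero : Subsingleton (Abelian.Ext.{u} (ModuleCat.of Λ T) (ModuleCat.of Λ T) 1)
  coresolution : ∃ (T₀ T₁ : ModuleCat.{u} Λ) (f : Λ →ₗ[Λ] T₀) (g : T₀ →ₗ[Λ] T₁),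
    InAdd Λ T T₀ ∧ InAdd Λ T T₁ ∧
    Function.Injective f ∧ Function.Exact f g ∧ Function.Surjective g

/-- The submodule `N` of `M` meets every nonzero submodule of `M` nontrivially. -/
def IsEssentialSubmodule {M : Type u} [AddCommGroup M] [Module Λ M] (N : Submodule Λ M) : Prop :=
  ∀ K : Submodule Λ M, K ≠ ⊥ → N ⊓ K ≠ ⊥

/-- A minimal injective resolution `0 → M → I₀ → I₁ → ⋯`: an exact sequence with all `Iₖ`
injective in which the image of every map is essential in its target, i.e. `I₀` is the injective
envelope of `M` and `Iₖ₊₁` is the injective envelope of the cokernel of the preceding map. -/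
structure MinimalInjectiveResolution (M : Type u) [AddCommGroup M] [Module Λ M] where
  I : ℕ → ModuleCat.{u} Λ
  ι : M →ₗ[Λ] I 0
  d : ∀ k, I k →ₗ[Λ] I (k + 1)
  injective : ∀ k, Module.Injective Λ (I k)
  ι_injective : Function.Injective ι
  exact_zero : Function.Exact ι (d 0)
  exact_succ : ∀ k, Function.Exact (d k) (d (k + 1))
  ι_essential : IsEssentialSubmodule Λ (LinearMap.range ι)
  d_essential : ∀ k, IsEssentialSubmodule Λ (LinearMap.range (d k))

/-- The dominant dimension of `M`: the supremum of all `k` such that the first `k` terms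
`I₀, …, Iₖ₋₁` of a minimal injective resolution of `M` are projective. -/
noncomputable def domDim (M : Type u) [AddCommGroup M] [Module Λ M] : ℕ∞ :=
  ⨆ (r : MinimalInjectiveResolution Λ M) (k : ℕ)
    (_ : ∀ i < k, Module.Projective Λ (r.I i)), (k : ℕ∞)

/-- `f : P → M` is a projective cover: `P` is projective and `f` is surjective with superfluous
kernel. -/
structure IsProjectiveCover {P M : Type u} [AddCommGroup P] [Module Λ P]
    [AddCommGroup M] [Module Λ M] (f : P →ₗ[Λ] M) : Prop where
  projective : Module.Projective Λ P
  surjective : Function.Surjective f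
  superfluous : ∀ N : Submodule Λ P, N ⊔ LinearMap.ker f = ⊤ → N = ⊤

end Modules

section Algebras

variable (Λ : Type u) [Ring Λ]

/-- The algebra is basic: `Λ` is, as a left module over itself, a direct sum of pairwise
non-isomorphic indecomposable modules. -/
def IsBasicAlgebra : Prop := IsBasicModule Λ Λ

/-- The algebra is connected: it is nonzero and has no nontrivial central idempotents. -/
def IsConnectedAlgebra : Prop :=
  Nontrivial Λ ∧ ∀ e : Λ, IsIdempotentElem e → e ∈ Subring.center Λ → e = 0 ∨ e = 1

/-- The finitely generated indecomposable projective modules and the finitely generated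
indecomposable injective modules are uniserial. -/
structure IsNakayama : Prop where
  projective_uniserial : ∀ M : ModuleCat.{u} Λ, Module.Finite Λ M → IsIndecomposable Λ M →
    Module.Projective Λ M → IsUniserial Λ M
  injective_uniserial : ∀ M : ModuleCat.{u} Λ, Module.Finite Λ M → IsIndecomposable Λ M →
    Module.Injective Λ M → IsUniserial Λ M

/-- The ordinary quiver of `Λ` has an arrow from the vertex of the simple module `S` to the
vertex of the simple module `S'`, that is, `Ext¹(S, S') ≠ 0`. -/
def HasArrow (S S' : Type u) [AddCommGroup S] [Module Λ S] [AddCommGroup S'] [Module Λ S'] :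
    Prop :=
  Nontrivial (Abelian.Ext.{u} (ModuleCat.of Λ S) (ModuleCat.of Λ S') 1)

/-- The ordinary quiver of `Λ` is a complete oriented cycle with `n` vertices: the simple modules
up to isomorphism are `Sᵢ`, `i ∈ ℤ/n`, without repetition, and the arrows are exactly
`i + 1 → i`. Such a labelling comes with the projective covers `Pᵢ → Sᵢ`. -/
structure CyclicLabelling (n : ℕ) where
  S : ZMod n → ModuleCat.{u} Λ
  simple : ∀ i, IsSimpleModule Λ (S i)
  distinct : ∀ i j, Nonempty (S i ≃ₗ[Λ] S j) → i = j
  complete : ∀ M : ModuleCat.{u} Λ, IsSimpleModule Λ M → ∃ i, Nonempty (M ≃ₗ[Λ] S i)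
  arrow_iff : ∀ i j, HasArrow Λ (S i) (S j) ↔ i = j + 1
  P : ZMod n → ModuleCat.{u} Λ
  cover : ∀ i, P i →ₗ[Λ] S i
  isProjectiveCover : ∀ i, IsProjectiveCover Λ (cover i)

end Algebras

/-- The set `Q_c = {i ∈ ℤ/n | c_{i+1} ≤ c_i}`. -/
def setQ {n : ℕ} (c : ZMod n → ℕ) : Set (ZMod n) := {i | c (i + 1) ≤ c i}

/-- The set `P_c = {i ∈ ℤ/n | c_{i+1} = c_i + 1}`. -/
def setP {n : ℕ} (c : ZMod n → ℕ) : Set (ZMod n) := {i | c (i + 1) = c i + 1}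

end NakayamaTilting

/-! Both equivalences pass through one condition, `HasProjInjCopresentation`: there is an exact
sequence 0 → Λ → I₀ → I₁ with I₀, I₁ finitely generated projective-injective. By `two_le_domDim_iff`
this is dominant dimension at least 2, since the envelopes in a minimal resolution are summands of
any such I₀, I₁.

Tilting. Given the sequence, let K be the cokernel of Λ → I₀. The basic part of I₀ ⊕ K is tilting: 0
→ Λ → I₀ → K → 0 bounds its projective dimension and is the required coresolution, and Ext¹ vanishes
because a module of projective dimension at most 1 has no extensions by quotients of injectives. It
lies in the subcategory because K embeds into I₁. Conversely, a coresolution 0 → Λ → T₀ → T₁ → 0 by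
modules generated and cogenerated by Q is turned into a copresentation by powers of Q.

Combinatorics. P_i is uniserial with factors S_i, S_{i-1}, … from the top, so its socle is
S_{j-c_j+1} for i = j (`nonempty_equiv_of_atom`). P_i fails to be injective exactly when c_{i+1} =
c_i + 1, and then P_i is the radical of P_{i+1} (`exists_radical_embedding`,
`length_eq_of_not_injective`). The cokernel of P_i in an injective P_k ⊇ P_{i+1} has socle S_{i+1},
so a copresentation exists exactly when S_{i+1} is the socle of some injective P_j, that is, i = j -
c_j with j ∈ Q_c. -/

namespace NakayamaTilting

/-! ### Injective envelopes, minimal resolutions and dominant dimension. -/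

section Envelopes

variable {Λ : Type u} [Ring Λ]

theorem injective_of_retract {M X : Type u} [AddCommGroup M] [Module Λ M] [AddCommGroup X]
    [Module Λ X] [Module.Injective Λ X] (i : M →ₗ[Λ] X) (p : X →ₗ[Λ] M)
    (h : ∀ x, p (i x) = x) : Module.Injective Λ M where
  out Y Z _ _ _ _ f hf g := by
    obtain ⟨k, hk⟩ := Module.Injective.out (Q := X) f hf (i ∘ₗ g)
    exact ⟨p ∘ₗ k, fun x => by simp [hk, h]⟩

theorem injective_of_linearEquiv {M X : Type u} [AddCommGroup M] [Module Λ M] [AddCommGroup X]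
    [Module Λ X] (e : X ≃ₗ[Λ] M) (_ : Module.Injective Λ X) : Module.Injective Λ M :=
  injective_of_retract e.symm.toLinearMap e.toLinearMap (by simp)

theorem IsEssentialSubmodule.injective {M : Type u} {X : Type*} [AddCommGroup M]
    [Module Λ M] [AddCommGroup X] [Module Λ X] {N : Submodule Λ M} (hN : IsEssentialSubmodule Λ N)
    (f : M →ₗ[Λ] X) (hf : ∀ x ∈ N, f x = 0 → x = 0) : Function.Injective f := by
  rw [← LinearMap.ker_eq_bot]
  by_contra h
  refine hN _ h ((Submodule.eq_bot_iff _).2 fun x hx => hf x hx.1 hx.2)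

/-- A submodule `N` of an injective module is essential in a direct summand. -/
theorem exists_essential_retract {J : Type u} [AddCommGroup J] [Module Λ J] [Module.Injective Λ J]
    (N : Submodule Λ J) : ∃ E : Submodule Λ J, N ≤ E ∧
      (∀ K ≤ E, K ≠ ⊥ → N ⊓ K ≠ ⊥) ∧ ∃ p : J →ₗ[Λ] E, ∀ x : E, p x = x := by
  obtain ⟨E, hNE, hE⟩ := zorn_le_nonempty₀
    {E : Submodule Λ J | N ≤ E ∧ ∀ K ≤ E, K ≠ ⊥ → N ⊓ K ≠ ⊥} (by
      intro c hc hchain y hy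
      refine ⟨sSup c, ⟨(hc hy).1.trans (le_sSup hy), fun K hK hK0 => ?_⟩, fun z hz => le_sSup hz⟩
      obtain ⟨k, hkK, hk0⟩ := (Submodule.ne_bot_iff _).1 hK0
      obtain ⟨E, hE, hkE⟩ := (Submodule.mem_sSup_of_directed ⟨y, hy⟩ hchain.directedOn).1 (hK hkK)
      have h := (hc hE).2 (Λ ∙ k) (by simpa using hkE) (by simpa using hk0)
      exact fun h' => h (le_bot_iff.1 (h' ▸ inf_le_inf_left N (by simpa using hkK))))
    N ⟨le_rfl, fun K hK hK0 => by rwa [inf_eq_right.2 hK]⟩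
  -- `E` is a maximal essential extension of `N` in `J`, and `C` is maximal among submodules
  -- disjoint from `E`. Maximality of `C` makes `E` essential in `J ⧸ C`, so the extension `h : J ⧸
  -- C → J` of the inclusion of `E` is injective; its range is again essential over `N`, hence
  -- equals `E`.
  obtain ⟨C, -, hC⟩ := zorn_le_nonempty₀ {C : Submodule Λ J | Disjoint E C} (by
      intro c hc hchain y hy
      refine ⟨sSup c, ?_, fun z hz => le_sSup hz⟩
      exact (DirectedOn.disjoint_sSup_right hchain.directedOn).2 fun z hz => hc hz)
    ⊥ disjoint_bot_right
  have hdisj : Disjoint E C := hC.prop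
  have hq : Function.Injective (C.mkQ ∘ₗ E.subtype) := by
    rw [← LinearMap.ker_eq_bot, Submodule.eq_bot_iff]
    intro x hx
    have : (x : J) ∈ C := by simpa using hx
    exact Subtype.ext (Submodule.disjoint_def.1 hdisj _ x.2 this)
  obtain ⟨h, hh⟩ := Module.Injective.out (Q := J) _ hq E.subtype
  have hh' : ∀ x ∈ E, h (C.mkQ x) = x := fun x hx => hh ⟨x, hx⟩
  have hess : ∀ K : Submodule Λ (J ⧸ C), K ≠ ⊥ → ∃ e ∈ E, e ≠ 0 ∧ C.mkQ e ∈ K := by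
    intro K hK
    by_contra! hcon
    have hd : Disjoint E (K.comap C.mkQ) :=
      Submodule.disjoint_def.2 fun x hx hx' => by_contra fun h0 => hcon x hx h0 hx'
    have hle : C ≤ K.comap C.mkQ := fun x hx => by
      simp [(Submodule.Quotient.mk_eq_zero C).2 hx]
    have heq := hC.le_of_ge hd hle
    refine hK ((Submodule.eq_bot_iff _).2 fun x hx => ?_)
    obtain ⟨x, rfl⟩ := C.mkQ_surjective x
    exact (Submodule.Quotient.mk_eq_zero C).2 (heq hx)
  have hinj : Function.Injective h := by
    rw [← LinearMap.ker_eq_bot]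
    by_contra hker
    obtain ⟨e, he, he0, hek⟩ := hess _ hker
    exact he0 ((hh' e he).symm.trans hek)
  have hle : E ≤ LinearMap.range h := fun x hx => ⟨_, hh' x hx⟩
  have hrange : LinearMap.range h ≤ E := by
    refine hE.le_of_ge ⟨hNE.trans hle, fun K hK hK0 => ?_⟩ hle
    have hcomap : K.comap h ≠ ⊥ := by
      obtain ⟨k, hk, hk0⟩ := (Submodule.ne_bot_iff _).1 hK0
      obtain ⟨x, rfl⟩ := hK hk
      exact (Submodule.ne_bot_iff _).2 ⟨x, hk, fun hx => hk0 (by simp [hx])⟩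
    obtain ⟨e, he, he0, hek⟩ := hess _ hcomap
    have h1 : E ⊓ K ≠ ⊥ :=
      (Submodule.ne_bot_iff _).2 ⟨e, ⟨he, (hh' e he) ▸ hek⟩, he0⟩
    have h2 := hE.prop.2 (E ⊓ K) inf_le_left h1
    exact fun h' => h2 (le_bot_iff.1 (h' ▸ inf_le_inf_left N inf_le_right))
  exact ⟨E, hNE, hE.prop.2,
    (h ∘ₗ C.mkQ).codRestrict E fun x => hrange ⟨_, rfl⟩, fun x => Subtype.ext (hh' x x.2)⟩

/-- An injective map `f` into an injective module factors through an injective envelope which is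
a direct summand. -/
theorem exists_envelope {M J : Type u} [AddCommGroup M] [Module Λ M] [AddCommGroup J] [Module Λ J]
    [Module.Injective Λ J] (f : M →ₗ[Λ] J) (hf : Function.Injective f) :
    ∃ (E : ModuleCat.{u} Λ) (ι : M →ₗ[Λ] E) (i : E →ₗ[Λ] J) (p : J →ₗ[Λ] E),
      Function.Injective ι ∧ IsEssentialSubmodule Λ (LinearMap.range ι) ∧
      Module.Injective Λ E ∧ (∀ x, p (i x) = x) ∧ i ∘ₗ ι = f := by
  obtain ⟨E, hNE, hE, p, hp⟩ := exists_essential_retract (LinearMap.range f)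
  refine ⟨ModuleCat.of Λ E, f.codRestrict E fun x => hNE ⟨x, rfl⟩, E.subtype, p,
    fun x y h => hf (congrArg Subtype.val h), fun K hK => ?_,
    injective_of_retract E.subtype p hp, hp, rfl⟩
  have hK' : K.map E.subtype ≠ ⊥ := by
    rw [← Submodule.map_bot E.subtype]
    exact fun h => hK (Submodule.map_injective_of_injective E.subtype_injective h)
  obtain ⟨k, ⟨⟨x, hx⟩, y, hy, hxy⟩, hk0⟩ :=
    (Submodule.ne_bot_iff _).1 (hE _ (Submodule.map_subtype_le _ _) hK')
  refine (Submodule.ne_bot_iff _).2 ⟨y, ⟨⟨x, Subtype.ext ?_⟩, hy⟩, fun h => hk0 ?_⟩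
  · simpa using hx.trans hxy.symm
  · simpa [h] using hxy.symm

theorem exists_injective_embedding (M : Type u) [AddCommGroup M] [Module Λ M] :
    ∃ (J : ModuleCat.{u} Λ) (f : M →ₗ[Λ] J), Module.Injective Λ J ∧ Function.Injective f := by
  let ι := Injective.ι (ModuleCat.of Λ M)
  exact ⟨Injective.under (ModuleCat.of Λ M), ι.hom,
    (Module.injective_iff_injective_object Λ _).2
      (inferInstanceAs (Injective (Injective.under (ModuleCat.of Λ M)))),
    (ModuleCat.mono_iff_injective ι).1 inferInstance⟩

/-- An injective envelope of `M`. -/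
structure Envelope (M : Type u) [AddCommGroup M] [Module Λ M] where
  E : ModuleCat.{u} Λ
  ι : M →ₗ[Λ] E
  injective : Module.Injective Λ E
  ι_injective : Function.Injective ι
  ι_essential : IsEssentialSubmodule Λ (LinearMap.range ι)

theorem nonempty_envelope (M : Type u) [AddCommGroup M] [Module Λ M] :
    Nonempty (Envelope (Λ := Λ) M) := by
  obtain ⟨J, f, hJ, hf⟩ := exists_injective_embedding (Λ := Λ) M
  obtain ⟨E, ι, i, p, h1, h2, h3, -, -⟩ := exists_envelope f hf
  exact ⟨⟨E, ι, h3, h1, h2⟩⟩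

/-- A chosen injective envelope of `M`. -/
noncomputable def envelope (M : Type u) [AddCommGroup M] [Module Λ M] : Envelope (Λ := Λ) M :=
  (nonempty_envelope M).some

/-- The cosyzygies of `M`. -/
noncomputable def cosyzygy (M : ModuleCat.{u} Λ) : ℕ → ModuleCat.{u} Λ
  | 0 => M
  | k + 1 => ModuleCat.of Λ ((envelope (Λ := Λ) (cosyzygy M k)).E ⧸
      LinearMap.range (envelope (Λ := Λ) (cosyzygy M k)).ι)

theorem exact_comp_mkQ {A B X : Type*} [AddCommGroup A] [Module Λ A] [AddCommGroup B] [Module Λ B]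
    [AddCommGroup X] [Module Λ X] (f : A →ₗ[Λ] B) (g : (B ⧸ LinearMap.range f) →ₗ[Λ] X)
    (hg : Function.Injective g) : Function.Exact f (g ∘ₗ (LinearMap.range f).mkQ) := by
  intro x
  rw [LinearMap.comp_apply, map_eq_zero_iff g hg, Submodule.mkQ_apply,
    Submodule.Quotient.mk_eq_zero]
  rfl

theorem exact_mkQ_comp {A B X Y : Type*} [AddCommGroup A] [Module Λ A] [AddCommGroup B] [Module Λ B]
    [AddCommGroup X] [Module Λ X] [AddCommGroup Y] [Module Λ Y] (f : A →ₗ[Λ] B)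
    (hf : Function.Surjective f) (g : B →ₗ[Λ] X) (h : X →ₗ[Λ] Y) (H : Function.Exact g h) :
    Function.Exact (g ∘ₗ f) h := by
  intro x
  rw [H x]
  constructor
  · rintro ⟨y, rfl⟩
    obtain ⟨z, rfl⟩ := hf y
    exact ⟨z, rfl⟩
  · rintro ⟨y, rfl⟩
    exact ⟨f y, rfl⟩

theorem nonempty_minimalInjectiveResolution (M : ModuleCat.{u} Λ) :
    Nonempty (MinimalInjectiveResolution Λ M) := by
  let V : ∀ k, Envelope (Λ := Λ) (cosyzygy M k) := fun k => envelope _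
  let q : ∀ k, (V k).E →ₗ[Λ] cosyzygy M (k + 1) := fun k => (LinearMap.range (V k).ι).mkQ
  have hq : ∀ k, Function.Surjective (q k) := fun k => Submodule.mkQ_surjective _
  have hex : ∀ k, Function.Exact (V k).ι ((V (k + 1)).ι ∘ₗ q k) :=
    fun k => exact_comp_mkQ (V k).ι (V (k + 1)).ι (V (k + 1)).ι_injective
  refine ⟨⟨fun k => (V k).E, (V 0).ι, fun k => (V (k + 1)).ι ∘ₗ q k, fun k => (V k).injective,
    (V 0).ι_injective, hex 0, fun k => ?_, (V 0).ι_essential, fun k => ?_⟩⟩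
  · exact exact_mkQ_comp _ (hq k) _ _ (hex (k + 1))
  · rw [LinearMap.range_comp_of_range_eq_top _ (LinearMap.range_eq_top.2 (hq k))]
    exact (V (k + 1)).ι_essential

/-- Prepend an injective envelope of `M` to a minimal injective resolution of the cosyzygy. -/
def MinimalInjectiveResolution.cons {M : Type u} [AddCommGroup M] [Module Λ M]
    (V : Envelope (Λ := Λ) M) (r : MinimalInjectiveResolution Λ (V.E ⧸ LinearMap.range V.ι)) :
    MinimalInjectiveResolution Λ M where
  I := fun k => k.casesOn V.E r.I
  ι := V.ι
  d := fun k => match k with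
    | 0 => r.ι ∘ₗ (LinearMap.range V.ι).mkQ
    | k + 1 => r.d k
  injective := fun k => match k with
    | 0 => V.injective
    | k + 1 => r.injective k
  ι_injective := V.ι_injective
  exact_zero := exact_comp_mkQ V.ι r.ι r.ι_injective
  exact_succ := fun k => match k with
    | 0 => exact_mkQ_comp _ (Submodule.mkQ_surjective _) _ _ r.exact_zero
    | k + 1 => r.exact_succ k
  ι_essential := V.ι_essential
  d_essential := fun k => match k with
    | 0 => by
      rw [LinearMap.range_comp_of_range_eq_top _ (Submodule.range_mkQ _)]
      exact r.ι_essential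
    | k + 1 => r.d_essential k

/-- A projective module with an essential finitely generated submodule is finitely generated. -/
theorem finite_of_projective_of_essential [IsNoetherianRing Λ] {M : Type u} [AddCommGroup M]
    [Module Λ M] [Module.Projective Λ M] {N : Submodule Λ M} (hN : N.FG)
    (hess : IsEssentialSubmodule Λ N) : Module.Finite Λ M := by
  classical
  obtain ⟨s, hs⟩ := Module.projective_def.1 (inferInstance : Module.Projective Λ M)
  obtain ⟨t, rfl⟩ := hN
  -- `s` embeds `M` into a free module. The generators of `N` involve only the finitely many
  -- coordinates in `A`, so projecting to these is injective on `N`, hence on `M` by essentiality.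
  let A : Finset M := t.biUnion fun x => (s x).support
  let π : M →ₗ[Λ] (A → Λ) := LinearMap.pi fun a => Finsupp.lapply (a : M) ∘ₗ s
  have hle : Submodule.span Λ (t : Set M) ≤ (Finsupp.supported Λ Λ (A : Set M)).comap s := by
    refine Submodule.span_le.2 fun x hx => ?_
    simp only [Submodule.comap_coe, Set.mem_preimage, SetLike.mem_coe, Finsupp.mem_supported]
    exact_mod_cast Finset.subset_biUnion_of_mem (fun x => (s x).support) hx
  have hπ : Function.Injective π := hess.injective π fun x hx h0 => by
    have h1 : ((s x).support : Set M) ⊆ A := (Finsupp.mem_supported Λ _).1 (hle hx)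
    refine (hs.injective : Function.Injective s) (Finsupp.ext fun a => ?_)
    rw [map_zero, Finsupp.zero_apply]
    by_contra hne
    exact hne (congrFun h0 ⟨a, h1 (Finsupp.mem_support_iff.2 hne)⟩)
  exact Module.Finite.of_injective π hπ

/-- `M` is the kernel of a map between finitely generated projective-injective modules. -/
def HasProjInjCopresentation (Λ : Type u) [Ring Λ] (M : Type u) [AddCommGroup M] [Module Λ M] :
    Prop :=
  ∃ (I₀ I₁ : ModuleCat.{u} Λ) (f : M →ₗ[Λ] I₀) (g : I₀ →ₗ[Λ] I₁),
    (Module.Finite Λ I₀ ∧ Module.Projective Λ I₀ ∧ Module.Injective Λ I₀) ∧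
    (Module.Finite Λ I₁ ∧ Module.Projective Λ I₁ ∧ Module.Injective Λ I₁) ∧
    Function.Injective f ∧ Function.Exact f g

/-- Projective terms of a minimal resolution are finitely generated, being essential over finitely
generated images. In the other direction, the envelopes of `M` and of its cosyzygy split off `I₀`
and `I₁`, and any minimal resolution of the next cosyzygy completes the construction. -/
theorem two_le_domDim_iff [IsNoetherianRing Λ] (M : Type u) [AddCommGroup M] [Module Λ M]
    [Module.Finite Λ M] : 2 ≤ domDim Λ M ↔ HasProjInjCopresentation Λ M := by
  constructor
  · intro h
    -- The strict form yields one resolution and one `k > 1` from the supremum, so different minimal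
    -- resolutions need not be compared.
    have h1 : (1 : ℕ∞) < domDim Λ M := lt_of_lt_of_le (by norm_num) h
    simp only [domDim, lt_iSup_iff] at h1
    obtain ⟨r, k, hk, h1⟩ := h1
    have hk2 : 1 < k := by exact_mod_cast h1
    have p0 := hk 0 (by omega)
    have p1 := hk 1 (by omega)
    have f0 : Module.Finite Λ (r.I 0) :=
      finite_of_projective_of_essential
        ((LinearMap.range_eq_map r.ι) ▸ (Module.Finite.fg_top.map r.ι)) r.ι_essential
    have f1 : Module.Finite Λ (r.I 1) :=
      finite_of_projective_of_essential
        ((LinearMap.range_eq_map (r.d 0)) ▸ (Module.Finite.fg_top.map (r.d 0))) (r.d_essential 0)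
    exact ⟨r.I 0, r.I 1, r.ι, r.d 0, ⟨f0, p0, r.injective 0⟩, ⟨f1, p1, r.injective 1⟩,
      r.ι_injective, r.exact_zero⟩
  · rintro ⟨I₀, I₁, f, g, ⟨-, p0, i0⟩, ⟨-, p1, i1⟩, hf, hfg⟩
    obtain ⟨E, ι, i, p, h1, h2, h3, h4, h5⟩ := exists_envelope f hf
    let W : Envelope (Λ := Λ) M := ⟨E, ι, h3, h1, h2⟩
    have pE : Module.Projective Λ E :=
      Module.Projective.of_split i p (LinearMap.ext h4)
    have hi : Function.Injective i := Function.LeftInverse.injective h4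
    let g' : (E ⧸ LinearMap.range ι) →ₗ[Λ] I₁ := (LinearMap.range ι).liftQ (g ∘ₗ i) (by
      rintro _ ⟨x, rfl⟩
      have : i (ι x) = f x := LinearMap.congr_fun h5 x
      simpa [this] using hfg.apply_apply_eq_zero x)
    have hg' : Function.Injective g' := by
      rw [← LinearMap.ker_eq_bot]
      refine Submodule.ker_liftQ_eq_bot _ _ _ fun x hx => ?_
      obtain ⟨y, hy⟩ := (hfg (i x)).1 hx
      exact ⟨y, hi (by rw [← hy]; exact LinearMap.congr_fun h5 y)⟩
    obtain ⟨E', ι', i', p', h1', h2', h3', h4', -⟩ := exists_envelope g' hg'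
    let W' : Envelope (Λ := Λ) (E ⧸ LinearMap.range ι) := ⟨E', ι', h3', h1', h2'⟩
    have pE' : Module.Projective Λ E' :=
      Module.Projective.of_split i' p' (LinearMap.ext h4')
    obtain ⟨r⟩ := nonempty_minimalInjectiveResolution (ModuleCat.of Λ (E' ⧸ LinearMap.range ι'))
    let r' : MinimalInjectiveResolution Λ M := .cons W (.cons W' r)
    refine le_trans ?_ (le_iSup _ r')
    refine le_trans ?_ (le_iSup _ 2)
    refine le_trans ?_ (le_iSup _ ?_)
    · rfl
    · intro k hk
      interval_cases k
      · exact pE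
      · exact pE'

end Envelopes

/-! ### Indecomposable decompositions and additive closures. -/

section Decomposition

variable {Λ : Type u} [Ring Λ]

theorem isIndecomposable_iff (M : Type u) [AddCommGroup M] [Module Λ M] :
    IsIndecomposable Λ M ↔ Nontrivial M ∧
      ∀ A B : Submodule Λ M, IsCompl A B → A = ⊥ ∨ B = ⊥ := by
  unfold IsIndecomposable Indecomposable
  rw [ModuleCat.isZero_iff_subsingleton, not_subsingleton_iff_nontrivial]
  refine and_congr_right fun _ => ⟨fun h A B hAB => ?_, fun h Y Z e => ?_⟩
  · have e : ModuleCat.of Λ M ≅ ModuleCat.of Λ A ⊞ ModuleCat.of Λ B :=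
      (Submodule.prodEquivOfIsCompl A B hAB).symm.toModuleIso ≪≫
        (ModuleCat.biprodIsoProd (ModuleCat.of Λ A) (ModuleCat.of Λ B)).symm
    refine (h _ _ e).imp ?_ ?_ <;> intro h' <;>
    · rw [ModuleCat.isZero_iff_subsingleton] at h'
      exact (Submodule.subsingleton_iff_eq_bot).1 h'
  · let e' : M ≃ₗ[Λ] (Y × Z) := (e ≪≫ ModuleCat.biprodIsoProd Y Z).toLinearEquiv
    have hc : IsCompl (LinearMap.range (LinearMap.inl Λ Y Z)) (LinearMap.range (LinearMap.inr Λ Y Z)) :=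
      LinearMap.isCompl_range_inl_inr
    have hc' := hc.map (Submodule.orderIsoMapComap e'.symm)
    refine (h _ _ hc').imp ?_ ?_ <;> intro h' <;>
    · rw [map_eq_bot_iff, LinearMap.range_eq_bot] at h'
      rw [ModuleCat.isZero_iff_subsingleton]
      refine ⟨fun x y => ?_⟩
      have h1 := LinearMap.congr_fun h' x
      have h2 := LinearMap.congr_fun h' y
      simp only [LinearMap.inl_apply, LinearMap.inr_apply, LinearMap.zero_apply, Prod.mk_eq_zero,
        true_and, and_true] at h1 h2
      rw [h1, h2]

theorem IsIndecomposable.of_linearEquiv {M N : Type u} [AddCommGroup M] [Module Λ M]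
    [AddCommGroup N] [Module Λ N] (e : M ≃ₗ[Λ] N) (h : IsIndecomposable Λ M) :
    IsIndecomposable Λ N := by
  rw [isIndecomposable_iff] at h ⊢
  obtain ⟨hM, h⟩ := h
  refine ⟨e.symm.toEquiv.nontrivial, fun A B hAB => ?_⟩
  refine (h _ _ (hAB.map (Submodule.orderIsoMapComap e.symm))).imp ?_ ?_ <;>
    exact fun h' => (map_eq_bot_iff _).1 h'

/-- If `p ∘ i` is the identity of a nonzero module and the middle term is indecomposable, then
`i` is surjective. -/
theorem IsIndecomposable.surjective_of_retract {M X : Type u} [AddCommGroup M] [Module Λ M]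
    [AddCommGroup X] [Module Λ X] (hX : IsIndecomposable Λ X) [Nontrivial M]
    (i : M →ₗ[Λ] X) (p : X →ₗ[Λ] M) (h : ∀ x, p (i x) = x) : Function.Surjective i := by
  rw [isIndecomposable_iff] at hX
  have hc : IsCompl (LinearMap.range i) (LinearMap.ker p) := by
    rw [isCompl_iff, Submodule.disjoint_def, codisjoint_iff, Submodule.eq_top_iff']
    refine ⟨?_, fun x => ?_⟩
    · rintro _ ⟨x, rfl⟩ hx
      have : x = 0 := (h x).symm.trans hx
      simp [this]
    · exact Submodule.mem_sup.2 ⟨i (p x), ⟨_, rfl⟩, x - i (p x), by simp [h], by abel⟩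
  rcases hX.2 _ _ hc with h' | h'
  · obtain ⟨x, hx⟩ := exists_ne (0 : M)
    rw [LinearMap.range_eq_bot] at h'
    exact absurd (by rw [← h x, h']; simp) hx
  · rw [h'] at hc
    exact LinearMap.range_eq_top.1 (by simpa using hc.codisjoint)

/-- Strong induction on the length, which is finite over an artinian ring. Uniqueness of the
decomposition plays no role. -/
theorem exists_decomposition [IsArtinianRing Λ] (M : Type u) [AddCommGroup M] [Module Λ M]
    [Module.Finite Λ M] :
    ∃ (ι : Type) (_ : Fintype ι) (N : ι → ModuleCat.{u} Λ),
      (∀ i, IsIndecomposable Λ (N i)) ∧ Nonempty (M ≃ₗ[Λ] (∀ i, N i)) := by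
  obtain ⟨k, hk⟩ := ENat.ne_top_iff_exists.1 (Module.length_ne_top (R := Λ) (M := M))
  induction k using Nat.strong_induction_on generalizing M with
  | _ k ih =>
  by_cases hM : Nontrivial M
  · by_cases hI : IsIndecomposable Λ M
    · exact ⟨Unit, inferInstance, fun _ => ModuleCat.of Λ M, fun _ => hI,
        ⟨(LinearEquiv.funUnique Unit Λ M).symm⟩⟩
    · rw [isIndecomposable_iff] at hI
      push Not at hI
      obtain ⟨A, B, hAB, hA, hB⟩ := hI hM
      have e := Submodule.prodEquivOfIsCompl A B hAB
      have hlen := e.length_eq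
      rw [Module.length_prod, ← hk] at hlen
      obtain ⟨a, ha⟩ := ENat.ne_top_iff_exists.1 (Module.length_ne_top (R := Λ) (M := A))
      obtain ⟨b, hb⟩ := ENat.ne_top_iff_exists.1 (Module.length_ne_top (R := Λ) (M := B))
      have := Submodule.nontrivial_iff_ne_bot.2 hA
      have := Submodule.nontrivial_iff_ne_bot.2 hB
      have hpa := Module.length_pos (R := Λ) (M := A)
      have hpb := Module.length_pos (R := Λ) (M := B)
      rw [← ha, ← hb] at hlen
      rw [← ha] at hpa
      rw [← hb] at hpb
      norm_cast at hlen hpa hpb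
      obtain ⟨ι, _, N, hN, ⟨eN⟩⟩ := ih a (by omega) A ha
      obtain ⟨ι', _, N', hN', ⟨eN'⟩⟩ := ih b (by omega) B hb
      refine ⟨ι ⊕ ι', inferInstance, Sum.elim N N', ?_, ⟨?_⟩⟩
      · rintro (i | i)
        exacts [hN i, hN' i]
      · exact e.symm ≪≫ₗ (eN.prodCongr eN') ≪≫ₗ
          (LinearEquiv.sumPiEquivProdPi Λ ι ι' (fun i => (Sum.elim N N' i : ModuleCat Λ))).symm
  · rw [not_nontrivial_iff_subsingleton] at hM
    exact ⟨Empty, inferInstance, fun i => i.elim, fun i => i.elim,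
      ⟨LinearEquiv.ofSubsingleton _ _⟩⟩

/-- `M` is a direct summand of `X`. -/
def IsRetractOf (M X : Type u) [AddCommGroup M] [Module Λ M] [AddCommGroup X] [Module Λ X] : Prop :=
  ∃ (i : M →ₗ[Λ] X) (p : X →ₗ[Λ] M), ∀ x, p (i x) = x

theorem inAdd_of_retract {T M : Type u} [AddCommGroup T] [Module Λ T] [AddCommGroup M] [Module Λ M]
    {m : ℕ} (i : M →ₗ[Λ] (Fin m → T)) (p : (Fin m → T) →ₗ[Λ] M) (h : ∀ x, p (i x) = x) :
    InAdd Λ T M := by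
  have hi : Function.Injective i := Function.LeftInverse.injective h
  have hc : IsCompl (LinearMap.range i) (LinearMap.ker p) := by
    rw [isCompl_iff, Submodule.disjoint_def, codisjoint_iff, Submodule.eq_top_iff']
    refine ⟨?_, fun x => ?_⟩
    · rintro _ ⟨x, rfl⟩ hx
      have : x = 0 := (h x).symm.trans hx
      simp [this]
    · exact Submodule.mem_sup.2 ⟨i (p x), ⟨_, rfl⟩, x - i (p x), by simp [h], by abel⟩
  exact ⟨m, ModuleCat.of Λ (LinearMap.ker p),
    ⟨((LinearEquiv.ofInjective i hi).prodCongr (LinearEquiv.refl Λ _)) ≪≫ₗ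
      Submodule.prodEquivOfIsCompl _ _ hc⟩⟩

theorem InAdd.exists_retract {T M : Type u} [AddCommGroup T] [Module Λ T] [AddCommGroup M]
    [Module Λ M] (h : InAdd Λ T M) :
    ∃ (m : ℕ) (i : M →ₗ[Λ] (Fin m → T)) (p : (Fin m → T) →ₗ[Λ] M), ∀ x, p (i x) = x := by
  obtain ⟨m, M', ⟨e⟩⟩ := h
  exact ⟨m, e.toLinearMap ∘ₗ LinearMap.inl Λ M M', LinearMap.fst Λ M M' ∘ₗ e.symm.toLinearMap,
    by simp⟩

/-- If every member of a finite family is isomorphic to a member of a second family, then the sum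
of the first family is a direct summand of a power of the sum of the second. -/
theorem inAdd_pi {ι κ : Type} [Fintype ι] {N : ι → ModuleCat.{u} Λ}
    {N' : κ → ModuleCat.{u} Λ} (h : ∀ i, ∃ k, Nonempty (N i ≃ₗ[Λ] N' k)) :
    InAdd Λ (∀ k, N' k) (∀ i, N i) := by
  classical
  choose k e using h
  let e := fun i => (e i).some
  let E := Fintype.equivFin ι
  -- One copy of the whole second sum is spent on each index `i`; `N i` occupies its coordinate `k
  -- i`.
  refine inAdd_of_retract (m := Fintype.card ι)
    (LinearMap.pi fun a => LinearMap.single Λ (fun k => (N' k : Type u)) (k (E.symm a)) ∘ₗ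
      (e (E.symm a)).toLinearMap ∘ₗ LinearMap.proj (E.symm a))
    (LinearMap.pi fun i => (e i).symm.toLinearMap ∘ₗ LinearMap.proj (k i) ∘ₗ
      LinearMap.proj (E i)) fun x => ?_
  have key : ∀ j i, j = i → (e i).symm
      ((Pi.single (k j) (e j (x j)) : ∀ k, (N' k : Type u)) (k i)) = x i := by
    rintro j _ rfl
    rw [Pi.single_eq_same, LinearEquiv.symm_apply_apply]
  exact funext fun i => key _ _ (E.symm_apply_apply i)

theorem isRetractOf_pi_comp {ι κ : Type} [Fintype κ] {N : ι → ModuleCat.{u} Λ} (s : κ → ι)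
    (hs : Function.Injective s) :
    IsRetractOf (Λ := Λ) (∀ k, N (s k)) (∀ i, N i) := by
  classical
  refine ⟨∑ k, LinearMap.single Λ (fun i => (N i : Type u)) (s k) ∘ₗ LinearMap.proj k,
    LinearMap.pi fun k => LinearMap.proj (s k), fun x => ?_⟩
  ext k
  simp only [LinearMap.pi_apply, LinearMap.proj_apply, LinearMap.sum_apply, LinearMap.comp_apply,
    LinearMap.coe_single, Finset.sum_apply]
  rw [Finset.sum_eq_single k (fun b _ hb => Pi.single_eq_of_ne (fun h => hb (hs h).symm) _)
    (by simp), Pi.single_eq_same]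

/-- Every finitely generated module over an artinian ring has a basic direct summand which
generates the same additive subcategory. -/
theorem exists_basic [IsArtinianRing Λ] (Y : Type u) [AddCommGroup Y] [Module Λ Y]
    [Module.Finite Λ Y] : ∃ T : ModuleCat.{u} Λ, IsBasicModule Λ T ∧
      IsRetractOf (Λ := Λ) T Y ∧ InAdd Λ T Y := by
  classical
  obtain ⟨ι, _, N, hN, ⟨e⟩⟩ := exists_decomposition (Λ := Λ) Y
  -- One summand is kept from each isomorphism class.
  let r : Setoid ι := ⟨fun i j => Nonempty (N i ≃ₗ[Λ] N j), fun i => ⟨.refl _ _⟩,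
    fun ⟨e⟩ => ⟨e.symm⟩, fun ⟨e⟩ ⟨e'⟩ => ⟨e ≪≫ₗ e'⟩⟩
  let K := Quotient r
  have : Fintype K := Fintype.ofFinite _
  let E := Fintype.equivFin K
  let s : Fin (Fintype.card K) → ι := fun a => (E.symm a).out
  have hs : ∀ a b, Nonempty (N (s a) ≃ₗ[Λ] N (s b)) → a = b := fun a b h => by
    have : (⟦(E.symm a).out⟧ : K) = ⟦(E.symm b).out⟧ := Quotient.sound h
    simpa using this
  refine ⟨ModuleCat.of Λ (∀ a, N (s a)), ⟨_, fun a => N (s a), fun a => hN _, hs, ⟨.refl _ _⟩⟩,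
    ?_, ?_⟩
  · obtain ⟨i, p, hp⟩ := isRetractOf_pi_comp (N := N) s fun a b h => hs a b (h ▸ ⟨.refl _ _⟩)
    exact ⟨e.symm.toLinearMap ∘ₗ i, p ∘ₗ e.toLinearMap, by simpa using hp⟩
  · obtain ⟨m, i, p, hp⟩ := (inAdd_pi (N := N) (N' := fun a => N (s a)) fun i => ⟨E ⟦i⟧, by
      have : ⟦i⟧ = (⟦(E.symm (E ⟦i⟧)).out⟧ : K) := by simp
      exact Quotient.exact this⟩).exists_retract
    exact inAdd_of_retract (i ∘ₗ e.toLinearMap) (e.symm.toLinearMap ∘ₗ p) (by simp [hp])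

end Decomposition

/-! ### Extension groups and projective dimension. -/

section Ext

variable {Λ : Type u} [Ring Λ]

theorem shortExact_of {X Y Z : ModuleCat.{u} Λ} (f : X →ₗ[Λ] Y) (g : Y →ₗ[Λ] Z)
    (hf : Function.Injective f) (hfg : Function.Exact f g) (hg : Function.Surjective g) :
    (ShortComplex.mk (ModuleCat.ofHom f) (ModuleCat.ofHom g)
      (by ext x; exact hfg.apply_apply_eq_zero x)).ShortExact :=
  ModuleCat.shortComplex_shortExact _ hfg hf hg

/-- If `Ext¹(Z, B) = 0`, then maps to `B` extend along injections with cokernel `Z`. -/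
theorem exists_extend_of_ext_eq_zero {X Y Z B : ModuleCat.{u} Λ} (f : X →ₗ[Λ] Y) (g : Y →ₗ[Λ] Z)
    (hf : Function.Injective f) (hfg : Function.Exact f g) (hg : Function.Surjective g)
    (hZ : Subsingleton (Abelian.Ext.{u} Z B 1)) (h : X →ₗ[Λ] B) :
    ∃ h' : Y →ₗ[Λ] B, ∀ x, h' (f x) = h x := by
  have hS := shortExact_of f g hf hfg hg
  obtain ⟨x₂, hx₂⟩ := Abelian.Ext.contravariant_sequence_exact₁ (n₁ := 1) hS B
    (Abelian.Ext.mk₀ (ModuleCat.ofHom h)) rfl (hZ.elim _ _)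
  obtain ⟨k, rfl⟩ := (Abelian.Ext.mk₀_bijective _ _).2 x₂
  rw [Abelian.Ext.mk₀_comp_mk₀] at hx₂
  have := (Abelian.Ext.mk₀_bijective _ _).1 hx₂
  exact ⟨k.hom, fun x => congrArg (fun φ => φ.hom x) this⟩

/-- A module of projective dimension at most one has no extensions by modules generated by an
injective module. -/
theorem ext_eq_zero_of_generated {T X Q : ModuleCat.{u} Λ} [HasProjectiveDimensionLE T 1]
    [Module.Injective Λ Q] (q : Q →ₗ[Λ] X) (hq : Function.Surjective q) :
    Subsingleton (Abelian.Ext.{u} T X 1) := by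
  have hS := shortExact_of (X := ModuleCat.of Λ (LinearMap.ker q)) (LinearMap.ker q).subtype q
    (Submodule.subtype_injective _) (LinearMap.exact_subtype_ker_map q) hq
  have : Injective Q := Module.injective_object_of_injective_module Λ Q
  refine subsingleton_of_forall_eq 0 fun x => ?_
  -- In Ext¹(T, Q) → Ext¹(T, X) → Ext²(T, ker q) both outer groups vanish, by injectivity of `Q` and
  -- the projective dimension of `T`.
  obtain ⟨y, rfl⟩ := Abelian.Ext.covariant_sequence_exact₃ T hS x (n₁ := 2) rfl
    (Abelian.Ext.eq_zero_of_hasProjectiveDimensionLT _ 2 le_rfl)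
  rw [Abelian.Ext.eq_zero_of_injective y, Abelian.Ext.zero_comp]

theorem hasProjectiveDimensionLE_one {X Y Z : ModuleCat.{u} Λ} (f : X →ₗ[Λ] Y) (g : Y →ₗ[Λ] Z)
    (hf : Function.Injective f) (hfg : Function.Exact f g) (hg : Function.Surjective g)
    (hX : Module.Projective Λ X) (hY : Module.Projective Λ Y) : HasProjectiveDimensionLE Z 1 := by
  have := (IsProjective.iff_projective (R := Λ) X).1 hX
  have := (IsProjective.iff_projective (R := Λ) Y).1 hY
  have h1 : HasProjectiveDimensionLT X 1 := inferInstanceAs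
    (HasProjectiveDimensionLT (ModuleCat.of Λ X) 1)
  have h2 : HasProjectiveDimensionLT Y 1 := inferInstanceAs
    (HasProjectiveDimensionLT (ModuleCat.of Λ Y) 1)
  exact (shortExact_of f g hf hfg hg).hasProjectiveDimensionLT_X₃ 1 h1
    (hasProjectiveDimensionLT_of_ge Y 1 2 (by norm_num))

theorem hasProjectiveDimensionLE_prod {X Y : ModuleCat.{u} Λ} (hX : Module.Projective Λ X)
    (hY : HasProjectiveDimensionLE Y 1) :
    HasProjectiveDimensionLE (ModuleCat.of Λ (X × Y)) 1 := by
  have := (IsProjective.iff_projective (R := Λ) X).1 hX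
  have h1 : HasProjectiveDimensionLT X 1 := inferInstanceAs
    (HasProjectiveDimensionLT (ModuleCat.of Λ X) 1)
  have h2 : HasProjectiveDimensionLT X 2 := hasProjectiveDimensionLT_of_ge X 1 2 (by norm_num)
  have h3 : HasProjectiveDimensionLT Y 2 := hY
  exact hasProjectiveDimensionLT_of_iso (ModuleCat.biprodIsoProd X Y) 2

theorem IsRetractOf.hasProjectiveDimensionLE {T Y : ModuleCat.{u} Λ}
    (h : IsRetractOf (Λ := Λ) T Y) (hY : HasProjectiveDimensionLE Y 1) :
    HasProjectiveDimensionLE T 1 := by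
  obtain ⟨i, p, hp⟩ := h
  have r : Retract T Y := ⟨ModuleCat.ofHom i, ModuleCat.ofHom p, by ext x; exact hp x⟩
  exact r.hasProjectiveDimensionLT 2

end Ext

/-! ### Tilting modules and projective-injective copresentations. -/

section Tilting

variable {Λ : Type u} [Ring Λ]

theorem IsGeneratedBy.of_surjective {X M N : Type u} [AddCommGroup X] [Module Λ X]
    [AddCommGroup M] [Module Λ M] [AddCommGroup N] [Module Λ N] (h : IsGeneratedBy Λ X M)
    (f : M →ₗ[Λ] N) (hf : Function.Surjective f) : IsGeneratedBy Λ X N := by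
  obtain ⟨m, g, hg⟩ := h
  exact ⟨m, f ∘ₗ g, hf.comp hg⟩

theorem IsCogeneratedBy.of_injective {X M N : Type u} [AddCommGroup X] [Module Λ X]
    [AddCommGroup M] [Module Λ M] [AddCommGroup N] [Module Λ N] (h : IsCogeneratedBy Λ X M)
    (f : N →ₗ[Λ] M) (hf : Function.Injective f) : IsCogeneratedBy Λ X N := by
  obtain ⟨m, g, hg⟩ := h
  exact ⟨m, g ∘ₗ f, hg.comp hf⟩

/-- The decomposition of a power into two smaller powers. -/
def finAddArrowEquiv (X : Type u) [AddCommGroup X] [Module Λ X] (m k : ℕ) :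
    (Fin (m + k) → X) ≃ₗ[Λ] (Fin m → X) × (Fin k → X) :=
  LinearEquiv.funCongrLeft Λ X finSumFinEquiv ≪≫ₗ
    LinearEquiv.sumArrowLequivProdArrow (Fin m) (Fin k) Λ X

theorem IsGeneratedBy.prod {X M N : Type u} [AddCommGroup X] [Module Λ X]
    [AddCommGroup M] [Module Λ M] [AddCommGroup N] [Module Λ N] (h : IsGeneratedBy Λ X M)
    (h' : IsGeneratedBy Λ X N) : IsGeneratedBy Λ X (M × N) := by
  obtain ⟨m, g, hg⟩ := h
  obtain ⟨k, g', hg'⟩ := h'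
  exact ⟨m + k, g.prodMap g' ∘ₗ (finAddArrowEquiv (Λ := Λ) X m k).toLinearMap,
    (hg.prodMap hg').comp (LinearEquiv.surjective _)⟩

theorem IsCogeneratedBy.prod {X M N : Type u} [AddCommGroup X] [Module Λ X]
    [AddCommGroup M] [Module Λ M] [AddCommGroup N] [Module Λ N] (h : IsCogeneratedBy Λ X M)
    (h' : IsCogeneratedBy Λ X N) : IsCogeneratedBy Λ X (M × N) := by
  obtain ⟨m, g, hg⟩ := h
  obtain ⟨k, g', hg'⟩ := h'
  exact ⟨m + k, (finAddArrowEquiv (Λ := Λ) X m k).symm.toLinearMap ∘ₗ g.prodMap g',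
    (finAddArrowEquiv (Λ := Λ) X m k).symm.injective.comp (hg.prodMap hg')⟩

theorem InAdd.isGeneratedBy {X M : Type u} [AddCommGroup X] [Module Λ X] [AddCommGroup M]
    [Module Λ M] (h : InAdd Λ X M) : IsGeneratedBy Λ X M := by
  obtain ⟨m, i, p, h⟩ := h.exists_retract
  exact ⟨m, p, Function.LeftInverse.surjective h⟩

theorem InAdd.isCogeneratedBy {X M : Type u} [AddCommGroup X] [Module Λ X] [AddCommGroup M]
    [Module Λ M] (h : InAdd Λ X M) : IsCogeneratedBy Λ X M := by
  obtain ⟨m, i, p, h⟩ := h.exists_retract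
  exact ⟨m, i, Function.LeftInverse.injective h⟩

theorem InAdd.of_retract {T M Y : Type u} [AddCommGroup T] [Module Λ T] [AddCommGroup M]
    [Module Λ M] [AddCommGroup Y] [Module Λ Y] (h : InAdd Λ T Y) (i : M →ₗ[Λ] Y) (p : Y →ₗ[Λ] M)
    (hp : ∀ x, p (i x) = x) : InAdd Λ T M := by
  obtain ⟨m, j, q, h⟩ := h.exists_retract
  exact inAdd_of_retract (j ∘ₗ i) (p ∘ₗ q) (by simp [h, hp])

theorem IsGeneratedBy.trans {X Y M : Type u} [AddCommGroup X] [Module Λ X] [AddCommGroup Y]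
    [Module Λ Y] [AddCommGroup M] [Module Λ M] (h : IsGeneratedBy Λ X Y)
    (h' : IsGeneratedBy Λ Y M) : IsGeneratedBy Λ X M := by
  obtain ⟨m, g, hg⟩ := h
  obtain ⟨k, g', hg'⟩ := h'
  refine ⟨k * m, g' ∘ₗ (LinearMap.pi fun a => g ∘ₗ LinearMap.pi fun b =>
    LinearMap.proj (finProdFinEquiv (a, b))), hg'.comp fun y => ?_⟩
  choose s hs using hg
  refine ⟨fun c => s (y (finProdFinEquiv.symm c).1) (finProdFinEquiv.symm c).2, funext fun a => ?_⟩
  rw [← hs (y a)]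
  simp only [LinearMap.pi_apply, LinearMap.comp_apply]
  congr 1
  ext b
  change s (y (finProdFinEquiv.symm (finProdFinEquiv (a, b))).1)
    (finProdFinEquiv.symm (finProdFinEquiv (a, b))).2 = s (y a) b
  rw [Equiv.symm_apply_apply]

theorem IsCogeneratedBy.trans {X Y M : Type u} [AddCommGroup X] [Module Λ X] [AddCommGroup Y]
    [Module Λ Y] [AddCommGroup M] [Module Λ M] (h : IsCogeneratedBy Λ X Y)
    (h' : IsCogeneratedBy Λ Y M) : IsCogeneratedBy Λ X M := by
  obtain ⟨m, g, hg⟩ := h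
  obtain ⟨k, g', hg'⟩ := h'
  refine ⟨k * m, (LinearMap.pi fun c => LinearMap.proj (finProdFinEquiv.symm c).2 ∘ₗ g ∘ₗ
    LinearMap.proj (finProdFinEquiv.symm c).1) ∘ₗ g', fun x y h => ?_⟩
  refine hg' (funext fun a => hg (funext fun b => ?_))
  have h' : g (g' x (finProdFinEquiv.symm (finProdFinEquiv (a, b))).1)
      (finProdFinEquiv.symm (finProdFinEquiv (a, b))).2 =
    g (g' y (finProdFinEquiv.symm (finProdFinEquiv (a, b))).1)
      (finProdFinEquiv.symm (finProdFinEquiv (a, b))).2 := congrFun h (finProdFinEquiv (a, b))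
  rwa [Equiv.symm_apply_apply] at h'

theorem IsProjInjSum.finite_projective_injective {Q : Type u} [AddCommGroup Q] [Module Λ Q]
    (h : IsProjInjSum Λ Q) :
    Module.Finite Λ Q ∧ Module.Projective Λ Q ∧ Module.Injective Λ Q := by
  obtain ⟨t, N, hN, -, -, ⟨e⟩⟩ := h
  have h1 := fun i => (hN i).finite
  have h2 := fun i => (hN i).projective
  have h3 := fun i => (hN i).injective
  have : Module.Projective Λ (∀ i, N i) :=
    Module.Projective.of_equiv (DFinsupp.linearEquivFunOnFintype (R := Λ) (M := fun i => N i))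
  exact ⟨Module.Finite.equiv e.symm, Module.Projective.of_equiv e.symm,
    injective_of_linearEquiv e.symm (Module.Injective.pi Λ _)⟩

/-- The indecomposable summands of `I` are again projective-injective, so each is isomorphic to a
summand of `Q`. -/
theorem IsProjInjSum.inAdd [IsArtinianRing Λ] {Q : Type u} [AddCommGroup Q] [Module Λ Q]
    (h : IsProjInjSum Λ Q) {I : Type u} [AddCommGroup I] [Module Λ I] [Module.Finite Λ I]
    [Module.Projective Λ I] [Module.Injective Λ I] : InAdd Λ Q I := by
  classical
  obtain ⟨t, N, hN, -, hcomplete, ⟨e⟩⟩ := h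
  obtain ⟨ι, _, N', hN', ⟨e'⟩⟩ := exists_decomposition (Λ := Λ) I
  have hPI : ∀ i, IsIndecProjInj Λ (N' i) := fun i => by
    let j : N' i →ₗ[Λ] I := e'.symm.toLinearMap ∘ₗ LinearMap.single Λ (fun i => (N' i : Type u)) i
    let p : I →ₗ[Λ] N' i := LinearMap.proj i ∘ₗ e'.toLinearMap
    have hp : ∀ x, p (j x) = x := fun x => by simp [p, j]
    exact ⟨Module.Finite.of_surjective p (Function.LeftInverse.surjective hp), hN' i,
      Module.Projective.of_split j p (LinearMap.ext hp), injective_of_retract j p hp⟩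
  obtain ⟨m, i, p, hp⟩ :=
    (inAdd_pi (N := N') (N' := N) fun i => hcomplete _ (hPI i)).exists_retract
  refine inAdd_of_retract (m := m)
    ((LinearEquiv.piCongrRight fun _ => e.symm).toLinearMap ∘ₗ i ∘ₗ e'.toLinearMap)
    (e'.symm.toLinearMap ∘ₗ p ∘ₗ (LinearEquiv.piCongrRight fun _ => e).toLinearMap) fun x => ?_
  have : (LinearEquiv.piCongrRight fun _ => e) ((LinearEquiv.piCongrRight fun _ => e.symm)
      (i (e' x))) = i (e' x) := by
    ext; simp
  simp [this, hp]

/-- `T` is the basic part of I₀ ⊕ K, where K = I₀/Λ is a quotient of `I₀` and a submodule of `I₁`.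
-/
theorem exists_tilting_of_hasProjInjCopresentation [IsArtinianRing Λ] {Q : ModuleCat.{u} Λ}
    (hQ : IsProjInjSum Λ Q) (h : HasProjInjCopresentation Λ Λ) :
    ∃ T : ModuleCat.{u} Λ, IsTilting Λ T ∧ InSubcategoryC Λ T := by
  obtain ⟨I₀, I₁, f, g, ⟨_, p0, i0⟩, ⟨_, p1, i1⟩, hf, hfg⟩ := h
  let K := ModuleCat.of Λ (I₀ ⧸ LinearMap.range f)
  let q : I₀ →ₗ[Λ] K := (LinearMap.range f).mkQ
  have hq : Function.Surjective q := Submodule.mkQ_surjective _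
  have hexact : Function.Exact f q := LinearMap.exact_map_mkQ_range f
  have : Module.Finite Λ K := Module.Finite.of_surjective q hq
  obtain ⟨T, hbasic, hT, hadd⟩ := exists_basic (Λ := Λ) (I₀ × K)
  have hpd : HasProjectiveDimensionLE T 1 :=
    IsRetractOf.hasProjectiveDimensionLE (Y := ModuleCat.of Λ (I₀ × K)) hT
      (hasProjectiveDimensionLE_prod p0
        (hasProjectiveDimensionLE_one (X := ModuleCat.of Λ Λ) f q hf hexact hq
          (inferInstanceAs (Module.Projective Λ Λ)) p0))
  have hI0 : InAdd Λ Q I₀ := hQ.inAdd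
  have hI1 : InAdd Λ Q I₁ := hQ.inAdd
  let g' : K →ₗ[Λ] I₁ := (LinearMap.range f).liftQ g (by
    rintro _ ⟨x, rfl⟩
    exact hfg.apply_apply_eq_zero x)
  have hg' : Function.Injective g' := by
    rw [← LinearMap.ker_eq_bot]
    exact Submodule.ker_liftQ_eq_bot _ _ _ fun x hx => (hfg x).1 hx
  obtain ⟨i, p, hp⟩ := id hT
  have hgen : IsGeneratedBy Λ Q T :=
    (hI0.isGeneratedBy.prod (hI0.isGeneratedBy.of_surjective q hq)).of_surjective p
      (Function.LeftInverse.surjective hp)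
  have hcogen : IsCogeneratedBy Λ Q T :=
    (hI0.isCogeneratedBy.prod (hI1.isCogeneratedBy.of_injective g' hg')).of_injective i
      (Function.LeftInverse.injective hp)
  have hfin : Module.Finite Λ T :=
    Module.Finite.of_surjective p (Function.LeftInverse.surjective hp)
  obtain ⟨-, -, iQ⟩ := hQ.finite_projective_injective
  refine ⟨T, ⟨hfin, hbasic, hpd, ?_, I₀, K, f, q, ?_, ?_, hf, hexact, hq⟩, hfin, Q, hQ, hgen, hcogen⟩
  · obtain ⟨m, r, hr⟩ := hgen
    have : Module.Injective Λ (Fin m → Q) := Module.Injective.pi Λ _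
    exact ext_eq_zero_of_generated (T := T) (X := T) (Q := ModuleCat.of Λ (Fin m → Q)) r hr
  · exact hadd.of_retract (LinearMap.inl Λ I₀ K) (LinearMap.fst Λ I₀ K) fun x => rfl
  · exact hadd.of_retract (LinearMap.inr Λ I₀ K) (LinearMap.snd Λ I₀ K) fun x => rfl

/-- `T₀` embeds by `v` into a power of `Q`, with `u = v ∘ f`, but `T₀` need not be injective. A map
`h` back to `T₀` with `h ∘ u = f` still exists, and `x` lies in the image of `u` exactly when `x = v
(h x)` and `g (h x) = 0`; these two equations define the second map. -/
theorem hasProjInjCopresentation_of_exists_tilting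
    (h : ∃ T : ModuleCat.{u} Λ, IsTilting Λ T ∧ InSubcategoryC Λ T) :
    HasProjInjCopresentation Λ Λ := by
  obtain ⟨T, hT, -, Q, hQ, hgen, hcogen⟩ := h
  obtain ⟨T₀, T₁, f, g, hT0, hT1, hf, hfg, hg⟩ := hT.coresolution
  obtain ⟨a, p, hp⟩ := hgen.trans hT0.isGeneratedBy
  obtain ⟨b, v, hv⟩ := hcogen.trans hT0.isCogeneratedBy
  obtain ⟨d, w, hw⟩ := hcogen.trans hT1.isCogeneratedBy
  obtain ⟨fQ, pQ, iQ⟩ := hQ.finite_projective_injective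
  have hpow : ∀ k : ℕ, Module.Finite Λ (Fin k → Q) ∧ Module.Projective Λ (Fin k → Q) ∧
      Module.Injective Λ (Fin k → Q) := fun k => ⟨inferInstance,
    Module.Projective.of_equiv (DFinsupp.linearEquivFunOnFintype (R := Λ) (M := fun _ : Fin k => Q)),
    Module.Injective.pi Λ _⟩
  have := (hpow a).2.2
  have := (hpow b).2.2
  let u := v ∘ₗ f
  have hu : Function.Injective u := hv.comp hf
  -- Projectivity of `Λ` lifts `f` to the injective module `Fin a → Q`, where the lift can be
  -- extended along `u`.
  obtain ⟨l, hl⟩ := Module.projective_lifting_property p f hp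
  obtain ⟨l', hl'⟩ := Module.Injective.out (Q := Fin a → Q) u hu l
  let h : (Fin b → Q) →ₗ[Λ] T₀ := p ∘ₗ l'
  have hh : ∀ x, h (u x) = f x := fun x => by
    simp only [h, LinearMap.comp_apply, hl']
    exact LinearMap.congr_fun hl x
  refine ⟨ModuleCat.of Λ (Fin b → Q), ModuleCat.of Λ (Fin (b + d) → Q), u,
    (finAddArrowEquiv (Λ := Λ) Q b d).symm.toLinearMap ∘ₗ
      LinearMap.prod (LinearMap.id - v ∘ₗ h) (w ∘ₗ g ∘ₗ h), hpow b, hpow _, hu, fun x => ?_⟩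
  rw [LinearMap.comp_apply, LinearEquiv.coe_coe, LinearEquiv.map_eq_zero_iff]
  have key : LinearMap.prod (LinearMap.id - v ∘ₗ h) (w ∘ₗ g ∘ₗ h) x = 0 ↔
      x - v (h x) = 0 ∧ w (g (h x)) = 0 := Prod.mk_eq_zero
  rw [key, sub_eq_zero, map_eq_zero_iff w hw]
  constructor
  · rintro ⟨h1, h2⟩
    obtain ⟨y, hy⟩ := (hfg _).1 h2
    exact ⟨y, by rw [h1, ← hy]; rfl⟩
  · rintro ⟨y, rfl⟩
    rw [hh]
    exact ⟨rfl, hfg.apply_apply_eq_zero y⟩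

end Tilting

/-! ### Finitely generated injective modules over an artin algebra. -/

section Coinduced

/-- Evaluation at a nonzero `s` embeds the Hom module into `N`. It is injective because `s`
generates `S`; its values lie in `N` because the image of a nonzero map meets `N`, so the preimage
of `N` is all of the simple module `S`. -/
theorem isNoetherian_linearMap_of_isSimpleModule {Z S : Type*} {J : Type*} [CommRing Z]
    [AddCommGroup S] [Module Z S] [IsSimpleModule Z S] [AddCommGroup J] [Module Z J]
    (N : Submodule Z J) [IsNoetherian Z N] (hN : ∀ K : Submodule Z J, K ≠ ⊥ → N ⊓ K ≠ ⊥) :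
    IsNoetherian Z (S →ₗ[Z] J) := by
  have := IsSimpleModule.nontrivial Z S
  obtain ⟨s, hs⟩ := exists_ne (0 : S)
  have hmem : ∀ φ : S →ₗ[Z] J, φ s ∈ N := fun φ => by
    rcases eq_bot_or_eq_top (N.comap φ) with h | h
    · by_contra hφ
      have hr : LinearMap.range φ ≠ ⊥ := fun h0 =>
        hφ (by rw [LinearMap.range_eq_bot.1 h0]; exact N.zero_mem)
      obtain ⟨_, ⟨hy, x, rfl⟩, hx⟩ := (Submodule.ne_bot_iff _).1 (hN _ hr)
      have : x ∈ N.comap φ := hy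
      rw [h, Submodule.mem_bot] at this
      exact hx (by simp [this])
    · exact (h ▸ Submodule.mem_top : s ∈ N.comap φ)
  let ev : (S →ₗ[Z] J) →ₗ[Z] N := (LinearMap.applyₗ s).codRestrict N hmem
  refine isNoetherian_of_injective ev fun φ ψ h => LinearMap.ext fun x => ?_
  obtain ⟨z, rfl⟩ := IsSimpleModule.toSpanSingleton_surjective Z hs x
  have : φ s = ψ s := congrArg Subtype.val h
  simp [this]

/-- Dévissage along a composition series, by left exactness of Hom(-, J). -/
theorem IsFiniteLength.isNoetherian_linearMap {Z J : Type*} [CommRing Z] [AddCommGroup J]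
    [Module Z J] (N : Submodule Z J) [IsNoetherian Z N]
    (hN : ∀ K : Submodule Z J, K ≠ ⊥ → N ⊓ K ≠ ⊥)
    {M : Type*} [AddCommGroup M] [Module Z M] (hM : IsFiniteLength Z M) :
    IsNoetherian Z (M →ₗ[Z] J) := by
  induction hM with
  | of_subsingleton => infer_instance
  | @of_simple_quotient M _ _ A _ _ ih =>
    have := isNoetherian_linearMap_of_isSimpleModule (S := M ⧸ A) N hN
    refine isNoetherian_of_range_eq_ker (LinearMap.lcomp Z J A.mkQ) (LinearMap.lcomp Z J A.subtype) ?_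
    ext φ
    constructor
    · rintro ⟨ψ, rfl⟩
      exact LinearMap.ext fun x =>
        (congrArg ψ ((Submodule.Quotient.mk_eq_zero A).2 x.2)).trans (map_zero ψ)
    · intro h
      refine ⟨A.liftQ φ fun x hx => LinearMap.congr_fun h ⟨x, hx⟩, ?_⟩
      exact LinearMap.ext fun x => rfl

variable (Z Λ : Type u) [CommRing Z] [Ring Λ] [Algebra Z Λ]
  (J : Type u) [AddCommGroup J] [Module Z J]

/-- The coinduced module `Hom_Z(Λ, J)`. -/
def Coinduced : Type u := Λ →ₗ[Z] J

variable {Z Λ J} in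
/-- The underlying `Z`-linear map. -/
def Coinduced.toLinearMap (f : Coinduced Z Λ J) : Λ →ₗ[Z] J := f

noncomputable instance : AddCommGroup (Coinduced Z Λ J) := inferInstanceAs (AddCommGroup (Λ →ₗ[Z] J))

noncomputable instance : Module Z (Coinduced Z Λ J) := inferInstanceAs (Module Z (Λ →ₗ[Z] J))

noncomputable instance : Module Λ (Coinduced Z Λ J) where
  smul a f := (LinearMap.comp f (LinearMap.mulRight Z a) : Λ →ₗ[Z] J)
  one_smul := fun (f : Λ →ₗ[Z] J) => LinearMap.ext fun x => congrArg f (mul_one x)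
  mul_smul := fun a b (f : Λ →ₗ[Z] J) => LinearMap.ext fun x => congrArg f (mul_assoc x a b).symm
  smul_zero _ := rfl
  smul_add _ _ _ := rfl
  add_smul := fun a b (f : Λ →ₗ[Z] J) => LinearMap.ext fun x =>
    (congrArg f (mul_add x a b)).trans (map_add f _ _)
  zero_smul := fun (f : Λ →ₗ[Z] J) => LinearMap.ext fun x =>
    (congrArg f (mul_zero x)).trans (map_zero f)

instance : IsScalarTower Z Λ (Coinduced Z Λ J) where
  smul_assoc := fun z a (f : Λ →ₗ[Z] J) => LinearMap.ext fun x =>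
    (congrArg f (mul_smul_comm z x a)).trans (map_smul f z _)

variable {Z Λ J}

/-- The `Λ`-linear map to the coinduced module determined by a `Z`-linear map. -/
noncomputable def coinducedLift {M : Type*} [AddCommGroup M] [Module Λ M] [Module Z M] [IsScalarTower Z Λ M]
    (φ : M →ₗ[Z] J) : M →ₗ[Λ] Coinduced Z Λ J where
  toFun x := (φ ∘ₗ (LinearMap.toSpanSingleton Λ M x).restrictScalars Z : Λ →ₗ[Z] J)
  map_add' x y := LinearMap.ext fun a => (congrArg φ (smul_add a x y)).trans (map_add φ _ _)
  map_smul' b x := LinearMap.ext fun a => (congrArg φ (mul_smul a b x)).symm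

theorem coinducedLift_apply {M : Type*} [AddCommGroup M] [Module Λ M] [Module Z M]
    [IsScalarTower Z Λ M] (φ : M →ₗ[Z] J) (x : M) (a : Λ) :
    (coinducedLift φ x).toLinearMap a = φ (a • x) := rfl

/-- By the adjunction between restriction of scalars and coinduction, extending `g` over `Λ` amounts
to extending its evaluation at 1 over `Z`. -/
theorem coinduced_injective [Module.Injective Z J] : Module.Injective Λ (Coinduced Z Λ J) where
  out X Y _ _ _ _ f hf g := by
    let := Module.compHom X (algebraMap Z Λ)
    let := Module.compHom Y (algebraMap Z Λ)
    have : IsScalarTower Z Λ X := ⟨fun z a x => by rw [Algebra.smul_def, mul_smul]; rfl⟩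
    have : IsScalarTower Z Λ Y := ⟨fun z a x => by rw [Algebra.smul_def, mul_smul]; rfl⟩
    let ev : Coinduced Z Λ J →ₗ[Z] J := LinearMap.applyₗ (1 : Λ)
    obtain ⟨h, hh⟩ := Module.Injective.out (Q := J) (f.restrictScalars Z) hf
      (ev ∘ₗ g.restrictScalars Z)
    refine ⟨coinducedLift h, fun x => LinearMap.ext fun a => ?_⟩
    have h1 : h (a • f x) = (g (a • x)).toLinearMap 1 := by
      rw [← map_smul f]
      exact hh (a • x)
    rw [map_smul g] at h1
    exact h1.trans (congrArg (g x).toLinearMap (one_mul a))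

/-- A module over an artin algebra with an element contained in all nonzero submodules embeds
into a finitely generated injective module. -/
theorem exists_finite_injective_of_mem [IsArtinianRing Z] [Module.Finite Z Λ] {M : Type u}
    [AddCommGroup M] [Module Λ M] (b : M) (hb : b ≠ 0)
    (hmem : ∀ N : Submodule Λ M, N ≠ ⊥ → b ∈ N) :
    ∃ (X : ModuleCat.{u} Λ) (f : M →ₗ[Λ] X), Module.Finite Λ X ∧ Module.Injective Λ X ∧
      Function.Injective f := by
  let := Module.compHom M (algebraMap Z Λ)
  have : IsScalarTower Z Λ M := ⟨fun z a x => by rw [Algebra.smul_def, mul_smul]; rfl⟩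
  have htop : Ideal.torsionOf Z M b ≠ ⊤ := fun h => hb ((Ideal.torsionOf_eq_top_iff Z b).1 h)
  -- `Z ∙ b` maps onto `Z ⧸ m`, so some `Z`-linear `φ` into the envelope of `Z ⧸ m` has `φ b ≠ 0`.
  -- The induced map to the coinduced module does not kill `b`, and a nonzero kernel would contain
  -- `b`.
  obtain ⟨m, hm, hle⟩ := Ideal.exists_le_maximal _ htop
  let V : Envelope (Λ := Z) (Z ⧸ m) := envelope _
  have := V.injective
  have : IsSimpleModule Z (Z ⧸ m) := isSimpleModule_iff_isCoatom.2 hm.out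
  have : IsNoetherian Z (LinearMap.range V.ι) := inferInstance
  have hnoeth : IsNoetherian Z (Λ →ₗ[Z] V.E) :=
    IsFiniteLength.isNoetherian_linearMap _ V.ι_essential
      (isFiniteLength_iff_isNoetherian_isArtinian.2 ⟨inferInstance, inferInstance⟩)
  have hnoeth' : IsNoetherian Z (Coinduced Z Λ V.E) := hnoeth
  have : IsNoetherian Λ (Coinduced Z Λ V.E) := isNoetherian_of_tower Z hnoeth'
  let k : Submodule.span Z {b} →ₗ[Z] (Z ⧸ m) :=
    Submodule.factor hle ∘ₗ (Ideal.quotTorsionOfEquivSpanSingleton Z M b).symm.toLinearMap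
  obtain ⟨φ, hφ⟩ := Module.Injective.out (Q := V.E) (Submodule.span Z {b}).subtype
    (Submodule.subtype_injective _) (V.ι ∘ₗ k)
  have hφb : φ b ≠ 0 := by
    have hk : k ⟨b, Submodule.mem_span_singleton_self b⟩ = Submodule.Quotient.mk 1 := by
      have : (Ideal.quotTorsionOfEquivSpanSingleton Z M b).symm
          ⟨b, Submodule.mem_span_singleton_self b⟩ = Submodule.Quotient.mk 1 := by
        rw [LinearEquiv.symm_apply_eq]
        exact Subtype.ext (one_smul Z b).symm
      simp only [k, LinearMap.comp_apply, LinearEquiv.coe_coe, this]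
      rfl
    have := hφ ⟨b, Submodule.mem_span_singleton_self b⟩
    rw [LinearMap.comp_apply, hk] at this
    intro h0
    have h1 := this.symm.trans h0
    rw [map_eq_zero_iff _ V.ι_injective, Submodule.Quotient.mk_eq_zero] at h1
    exact hm.ne_top ((Ideal.eq_top_iff_one m).2 h1)
  refine ⟨ModuleCat.of Λ (Coinduced Z Λ V.E), coinducedLift φ, inferInstance,
    coinduced_injective, ?_⟩
  rw [← LinearMap.ker_eq_bot]
  by_contra hker
  have h0 : coinducedLift φ b = 0 := hmem _ hker
  refine hφb ?_
  have h1 := coinducedLift_apply φ b (1 : Λ)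
  rw [one_smul, h0] at h1
  exact h1.symm

/-- An artin algebra is an artin algebra over its centre. -/
theorem center_artinian {R : Type v} [CommRing R] [IsArtinianRing R] (Λ : Type u) [Ring Λ]
    [Algebra R Λ] [Module.Finite R Λ] :
    IsArtinianRing (Subring.center Λ) ∧ Module.Finite (Subring.center Λ) Λ := by
  let : Module R (Subring.center Λ) := inferInstanceAs (Module R (Subalgebra.center R Λ))
  let : IsScalarTower R (Subring.center Λ) (Subring.center Λ) :=
    inferInstanceAs (IsScalarTower R (Subalgebra.center R Λ) (Subalgebra.center R Λ))
  let : IsScalarTower R (Subring.center Λ) Λ :=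
    inferInstanceAs (IsScalarTower R (Subalgebra.center R Λ) Λ)
  have hfin : Module.Finite R (Subring.center Λ) :=
    Module.Finite.of_injective (Subalgebra.center R Λ).val.toLinearMap Subtype.val_injective
  exact ⟨IsArtinianRing.of_finite R _, Module.Finite.of_restrictScalars_finite R _ _⟩

end Coinduced

/-! ### Uniserial modules and lengths. -/

section Uniserial

variable {Λ : Type u} [Ring Λ]

/-- The range of `q` is comparable with `ker φ`. It cannot lie inside, so it contains `ker φ` and
maps onto `S`. -/
theorem IsUniserial.surjective {M X S : Type u} [AddCommGroup M] [Module Λ M] [AddCommGroup X]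
    [Module Λ X] [AddCommGroup S] [Module Λ S] [Nontrivial S] (hM : IsUniserial Λ M)
    (φ : M →ₗ[Λ] S) (q : X →ₗ[Λ] M) (h : Function.Surjective (φ ∘ₗ q)) :
    Function.Surjective q := by
  rcases hM (LinearMap.range q) (LinearMap.ker φ) with hle | hle
  · obtain ⟨s, hs⟩ := exists_ne (0 : S)
    obtain ⟨x, rfl⟩ := h s
    exact absurd (hle ⟨x, rfl⟩) hs
  · intro y
    obtain ⟨x, hx⟩ := h (φ y)
    have : y - q x ∈ LinearMap.range q := hle (by
      rw [LinearMap.mem_ker, map_sub, sub_eq_zero]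
      exact hx.symm)
    exact (Submodule.sub_mem_iff_left _ (LinearMap.mem_range_self q x)).1 this

theorem IsUniserial.submodule {M : Type u} [AddCommGroup M] [Module Λ M] (hM : IsUniserial Λ M)
    (N : Submodule Λ M) : IsUniserial Λ N := fun A B =>
  (hM (A.map N.subtype) (B.map N.subtype)).imp
    (Submodule.map_le_map_iff_of_injective N.subtype_injective _ _).1
    (Submodule.map_le_map_iff_of_injective N.subtype_injective _ _).1

theorem IsUniserial.isIndecomposable {M : Type u} [AddCommGroup M] [Module Λ M] [Nontrivial M]
    (hM : IsUniserial Λ M) : IsIndecomposable Λ M := by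
  rw [isIndecomposable_iff]
  refine ⟨inferInstance, fun A B hAB => ?_⟩
  rcases hM A B with h | h
  · exact Or.inl (disjoint_self.1 (hAB.disjoint.mono_right h))
  · exact Or.inr (disjoint_self.1 (hAB.disjoint.mono_left h))

theorem isUniserial_of_isSimpleModule {M : Type u} [AddCommGroup M] [Module Λ M]
    [IsSimpleModule Λ M] : IsUniserial Λ M := fun A _ =>
  (eq_bot_or_eq_top A).imp (fun h => h.trans_le bot_le) (fun h => le_top.trans_eq h.symm)

/-- An essential extension of a nonzero uniserial module is indecomposable. -/
theorem isIndecomposable_of_essential {M E : Type u} [AddCommGroup M] [Module Λ M] [Nontrivial M]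
    [AddCommGroup E] [Module Λ E] (hM : IsUniserial Λ M) (ι : M →ₗ[Λ] E)
    (hι : Function.Injective ι) (hess : IsEssentialSubmodule Λ (LinearMap.range ι)) :
    IsIndecomposable Λ E := by
  rw [isIndecomposable_iff]
  refine ⟨hι.nontrivial, fun A B hAB => ?_⟩
  have key : ∀ K : Submodule Λ E, K.comap ι = ⊥ → K = ⊥ := fun K hK => by
    by_contra h
    obtain ⟨_, ⟨⟨x, rfl⟩, hx⟩, h0⟩ := (Submodule.ne_bot_iff _).1 (hess K h)
    have : x ∈ K.comap ι := hx
    rw [hK, Submodule.mem_bot] at this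
    exact h0 (by simp [this])
  have hd : Disjoint (A.comap ι) (B.comap ι) := Submodule.disjoint_def.2 fun x hA hB =>
    hι (((Submodule.disjoint_def.1 hAB.disjoint) _ hA hB).trans (map_zero ι).symm)
  rcases hM (A.comap ι) (B.comap ι) with h | h
  · exact Or.inl (key _ (disjoint_self.1 (hd.mono_right h)))
  · exact Or.inr (key _ (disjoint_self.1 (hd.mono_left h)))

theorem length_of_covBy {M : Type u} [AddCommGroup M] [Module Λ M] {A B : Submodule Λ M}
    (h : A ⋖ B) : Module.length Λ B = Module.length Λ A + 1 := by
  have := (covBy_iff_quot_is_simple h.le).1 h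
  rw [Module.length_eq_add_of_exact (Submodule.inclusion h.le) (A.comap B.subtype).mkQ
    (Submodule.inclusion_injective _) (Submodule.mkQ_surjective _),
    Module.length_eq_one (R := Λ) (M := B ⧸ A.comap B.subtype)]
  intro x
  rw [Submodule.mkQ_apply, Submodule.Quotient.mk_eq_zero]
  exact ⟨fun hx => ⟨⟨x, hx⟩, rfl⟩, fun ⟨y, hy⟩ => hy ▸ y.2⟩

theorem injective_of_surjective_of_length_le {M N : Type u} [AddCommGroup M] [Module Λ M]
    [AddCommGroup N] [Module Λ N] (f : M →ₗ[Λ] N) (hf : Function.Surjective f) {a : ℕ}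
    (hM : Module.length Λ M ≤ a) (hN : (a : ℕ∞) ≤ Module.length Λ N) : Function.Injective f := by
  have h := Module.length_eq_add_of_exact (LinearMap.ker f).subtype f
    (Submodule.subtype_injective _) hf (LinearMap.exact_subtype_ker_map f)
  rw [← LinearMap.ker_eq_bot, ← Submodule.subsingleton_iff_eq_bot, ← Module.length_eq_zero_iff (R := Λ)]
  rw [h] at hM
  obtain ⟨b, hb⟩ := ENat.ne_top_iff_exists.1 (ne_top_of_le_ne_top (ENat.natCast_ne_top a)
    (le_self_add.trans hM))
  obtain ⟨d, hd⟩ := ENat.ne_top_iff_exists.1 (ne_top_of_le_ne_top (ENat.natCast_ne_top a)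
    (le_add_self.trans hM))
  rw [← hb, ← hd] at hM
  rw [← hd] at hN
  rw [← hb]
  norm_cast at *
  omega

theorem exists_simple_quotient {M : Type u} [AddCommGroup M] [Module Λ M]
    {A B : Submodule Λ M} (h : A ⋖ B) :
    ∃ (S : ModuleCat.{u} Λ) (φ : B →ₗ[Λ] S), IsSimpleModule Λ S ∧ Function.Surjective φ ∧
      ∀ x, φ x = 0 ↔ (x : M) ∈ A :=
  ⟨ModuleCat.of Λ (B ⧸ A.comap B.subtype), (A.comap B.subtype).mkQ,
    (covBy_iff_quot_is_simple h.le).1 h, Submodule.mkQ_surjective _, fun x => by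
      rw [Submodule.mkQ_apply, Submodule.Quotient.mk_eq_zero]; rfl⟩

end Uniserial

/-! ### The modules `P i` and their composition factors. -/

namespace CyclicLabelling

variable {Λ : Type u} [Ring Λ] {n : ℕ} (L : CyclicLabelling Λ n)

theorem simple_nontrivial (i : ZMod n) : Nontrivial (L.S i) :=
  have := L.simple i
  IsSimpleModule.nontrivial Λ _

theorem projective (i : ZMod n) : Module.Projective Λ (L.P i) := (L.isProjectiveCover i).projective

theorem cover_surjective (i : ZMod n) : Function.Surjective (L.cover i) :=
  (L.isProjectiveCover i).surjective

theorem isCoatom_ker {M : Type u} [AddCommGroup M] [Module Λ M] {i : ZMod n} (φ : M →ₗ[Λ] L.S i)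
    (hφ : Function.Surjective φ) : IsCoatom (LinearMap.ker φ) :=
  have := L.simple i
  LinearMap.isCoatom_ker_of_surjective hφ

theorem nontrivial (i : ZMod n) : Nontrivial (L.P i) :=
  have := L.simple_nontrivial i
  (L.cover_surjective i).nontrivial

/-- Any element outside the superfluous maximal submodule `ker (L.cover i)` is a generator. -/
theorem exists_span_singleton_eq_top (i : ZMod n) : ∃ x : L.P i, Submodule.span Λ {x} = ⊤ := by
  have := L.simple_nontrivial i
  obtain ⟨s, hs⟩ := exists_ne (0 : L.S i)
  obtain ⟨x, rfl⟩ := L.cover_surjective i s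
  refine ⟨x, (L.isProjectiveCover i).superfluous _ ?_⟩
  refine (L.isCoatom_ker _ (L.cover_surjective i)).2 _ (lt_of_le_of_ne le_sup_right fun h => hs ?_)
  have : x ∈ LinearMap.ker (L.cover i) := by
    rw [h]
    exact Submodule.mem_sup_left (Submodule.mem_span_singleton_self x)
  exact this

theorem finite (i : ZMod n) : Module.Finite Λ (L.P i) := by
  obtain ⟨x, hx⟩ := L.exists_span_singleton_eq_top i
  exact ⟨⟨{x}, by simpa using hx⟩⟩

theorem exists_retract (i : ZMod n) :
    ∃ (s : L.P i →ₗ[Λ] Λ) (r : Λ →ₗ[Λ] L.P i), ∀ x, r (s x) = x := by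
  obtain ⟨x, hx⟩ := L.exists_span_singleton_eq_top i
  have hr : Function.Surjective (LinearMap.toSpanSingleton Λ (L.P i) x) := by
    rw [← LinearMap.range_eq_top, ← LinearMap.span_singleton_eq_range, hx]
  have := L.projective i
  obtain ⟨s, hs⟩ := Module.projective_lifting_property _ LinearMap.id hr
  exact ⟨s, LinearMap.toSpanSingleton Λ (L.P i) x, LinearMap.congr_fun hs⟩

theorem isIndecomposable (i : ZMod n) : IsIndecomposable Λ (L.P i) := by
  rw [isIndecomposable_iff]
  refine ⟨L.nontrivial i, fun A B hAB => ?_⟩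
  have hm := L.isCoatom_ker _ (L.cover_surjective i)
  have key : ∀ N : Submodule Λ (L.P i), N = ⊤ ∨ N ≤ LinearMap.ker (L.cover i) := fun N => by
    by_cases h : N ≤ LinearMap.ker (L.cover i)
    · exact Or.inr h
    · refine Or.inl ((L.isProjectiveCover i).superfluous N (hm.2 _ ?_))
      exact lt_of_le_of_ne le_sup_right fun h' => h (h' ▸ le_sup_left)
  rcases key A with rfl | hA
  · exact Or.inr (top_disjoint.1 hAB.disjoint)
  rcases key B with rfl | hB
  · exact Or.inl (disjoint_top.1 hAB.disjoint)
  exact absurd (top_le_iff.1 (hAB.codisjoint.top_le.trans (sup_le hA hB))) hm.1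

theorem isUniserial (hnak : IsNakayama Λ) (i : ZMod n) : IsUniserial Λ (L.P i) :=
  hnak.projective_uniserial _ (L.finite i) (L.isIndecomposable i) (L.projective i)

/-- A uniserial module has at most one maximal submodule, so its simple quotient is determined. -/
theorem eq_of_surjective {M : Type u} [AddCommGroup M] [Module Λ M] (hM : IsUniserial Λ M)
    {i j : ZMod n} (φ : M →ₗ[Λ] L.S i) (ψ : M →ₗ[Λ] L.S j) (hφ : Function.Surjective φ)
    (hψ : Function.Surjective ψ) : i = j := by
  have h1 := L.isCoatom_ker φ hφ
  have h2 := L.isCoatom_ker ψ hψ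
  have h : LinearMap.ker φ = LinearMap.ker ψ := by
    rcases hM (LinearMap.ker φ) (LinearMap.ker ψ) with h | h
    · exact (h1.le_iff_eq h2.1).1 h |>.symm
    · exact (h2.le_iff_eq h1.1).1 h
  exact L.distinct i j ⟨(φ.quotKerEquivOfSurjective hφ).symm ≪≫ₗ Submodule.quotEquivOfEq _ _ h ≪≫ₗ
    ψ.quotKerEquivOfSurjective hψ⟩

theorem exists_lift {M : Type u} [AddCommGroup M] [Module Λ M] (hM : IsUniserial Λ M)
    {i : ZMod n} (φ : M →ₗ[Λ] L.S i) (hφ : Function.Surjective φ) :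
    ∃ q : L.P i →ₗ[Λ] M, Function.Surjective q ∧ ∀ x, φ (q x) = L.cover i x := by
  have := L.simple_nontrivial i
  have := L.projective i
  obtain ⟨q, hq⟩ := Module.projective_lifting_property φ (L.cover i) hφ
  exact ⟨q, hM.surjective φ q (hq ▸ L.cover_surjective i), LinearMap.congr_fun hq⟩

/-- Every simple subquotient is one of the `S x`. -/
theorem exists_surjective {M : Type u} [AddCommGroup M] [Module Λ M]
    {A B : Submodule Λ M} (h : A ⋖ B) :
    ∃ (x : ZMod n) (φ : B →ₗ[Λ] L.S x), Function.Surjective φ ∧ ∀ b, φ b = 0 ↔ (b : M) ∈ A := by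
  obtain ⟨S, φ, hS, hφ, hk⟩ := exists_simple_quotient h
  obtain ⟨x, ⟨e⟩⟩ := L.complete S hS
  exact ⟨x, e.toLinearMap ∘ₗ φ, e.surjective.comp hφ, fun b => by simp [hk]⟩

/-- Consecutive composition factors of a uniserial module are joined by an arrow. -/
theorem eq_add_one_of_covBy {M : Type u} [AddCommGroup M] [Module Λ M]
    (hM : IsUniserial Λ M) {B C : Submodule Λ M} (hBC : B ⋖ C) {x y : ZMod n}
    (φ : C →ₗ[Λ] L.S y) (hφ : Function.Surjective φ) (hφk : ∀ b, φ b = 0 ↔ (b : M) ∈ B)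
    (ψ : B →ₗ[Λ] L.S x) (hψ : Function.Surjective ψ) : y = x + 1 := by
  rw [← L.arrow_iff]
  by_contra harrow
  have hsub : Subsingleton (Abelian.Ext.{u} (L.S y) (L.S x) 1) :=
    not_nontrivial_iff_subsingleton.1 harrow
  -- Without an arrow `ψ` extends to `C`. Then `C = B + ker ψ'` while `B` is not inside `ker ψ'`, so
  -- the two are incomparable, against uniseriality.
  obtain ⟨ψ', hψ'⟩ := exists_extend_of_ext_eq_zero (X := ModuleCat.of Λ B) (Y := ModuleCat.of Λ C)
    (Submodule.inclusion hBC.le) φ (Submodule.inclusion_injective _)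
    (fun b => (hφk b).trans ⟨fun hb => ⟨⟨b, hb⟩, rfl⟩, fun ⟨z, hz⟩ => hz ▸ z.2⟩) hφ hsub ψ
  rcases hM ((LinearMap.ker ψ').map C.subtype) B with h | h
  · refine hBC.lt.not_ge fun z hz => ?_
    obtain ⟨b, hb⟩ := hψ (ψ' ⟨z, hz⟩)
    have h1 : (⟨z, hz⟩ - Submodule.inclusion hBC.le b : C) ∈ LinearMap.ker ψ' := by
      rw [LinearMap.mem_ker, map_sub, sub_eq_zero, hψ', hb]
    have h2 : z - b ∈ B := h ⟨_, h1, rfl⟩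
    exact (Submodule.sub_mem_iff_left _ b.2).1 h2
  · have := L.simple_nontrivial x
    obtain ⟨s, hs⟩ := exists_ne (0 : L.S x)
    obtain ⟨b, rfl⟩ := hψ s
    obtain ⟨z, hz, hzb⟩ := h b.2
    have : z = Submodule.inclusion hBC.le b := Subtype.ext hzb
    rw [this] at hz
    exact hs ((hψ' b).symm.trans hz)

/-- The composition factors of `P i`, from the top, are `S i, S (i - 1), …`. -/
theorem exists_factor [IsArtinianRing Λ] (hnak : IsNakayama Λ) (i : ZMod n) (k : ℕ) :
    ∀ (A B : Submodule Λ (L.P i)), A ⋖ B → Module.length Λ B + k = Module.length Λ (L.P i) →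
    ∀ j : ZMod n, j = i - k →
      ∃ ψ : B →ₗ[Λ] L.S j, Function.Surjective ψ ∧ ∀ b, ψ b = 0 ↔ (b : L.P i) ∈ A := by
  have := L.finite i
  have hu := L.isUniserial hnak i
  induction k with
  | zero =>
    intro A B hAB hlen j hj
    obtain rfl : j = i := by simpa using hj
    obtain rfl : B = ⊤ := by
      by_contra hB
      exact (Submodule.length_lt hB).ne (by simpa using hlen)
    have hA : IsCoatom A := covBy_top_iff.1 hAB
    have hm := L.isCoatom_ker _ (L.cover_surjective j)
    have h : A = LinearMap.ker (L.cover j) := by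
      rcases hu A (LinearMap.ker (L.cover j)) with h | h
      · exact ((hA.le_iff_eq hm.1).1 h).symm
      · exact (hm.le_iff_eq hA.1).1 h
    refine ⟨L.cover j ∘ₗ (⊤ : Submodule Λ (L.P j)).subtype, fun s => ?_, fun b => by rw [h]; rfl⟩
    obtain ⟨x, rfl⟩ := L.cover_surjective j s
    exact ⟨⟨x, trivial⟩, rfl⟩
  | succ k ih =>
    intro A B hAB hlen j hj
    have hB : ¬ IsMax B := by
      rw [isMax_iff_eq_top]
      rintro rfl
      rw [Module.length_top] at hlen
      obtain ⟨a, ha⟩ := ENat.ne_top_iff_exists.1 (Module.length_ne_top (R := Λ) (M := L.P i))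
      rw [← ha] at hlen
      norm_cast at hlen
      omega
    -- The factor `C / B` is one step nearer the top, so it is known by induction, and the arrow
    -- fixes the label of `B / A`.
    obtain ⟨C, hBC⟩ := exists_covBy_of_wellFoundedLT hB
    obtain ⟨φ, hφ, hφk⟩ := ih B C hBC
      (by rw [length_of_covBy hBC, ← hlen]; push_cast; ring) _ rfl
    obtain ⟨x, ψ, hψ, hψk⟩ := L.exists_surjective hAB
    have hx := L.eq_add_one_of_covBy hu hBC φ hφ hφk ψ hψ
    obtain rfl : j = x := by
      rw [hj]
      push_cast
      linear_combination hx
    exact ⟨ψ, hψ, hψk⟩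

theorem length_pos {c : ZMod n → ℕ} (hc : ∀ i, Module.length Λ (L.P i) = (c i : ℕ∞)) (i : ZMod n) :
    0 < c i := by
  have := L.nontrivial i
  have h := Module.length_pos (R := Λ) (M := L.P i)
  rw [hc i] at h
  exact_mod_cast h

end CyclicLabelling

/-! ### Copresentations of isomorphic modules and of finite sums. -/

theorem HasProjInjCopresentation.of_linearEquiv {Λ : Type u} [Ring Λ] {M N : Type u}
    [AddCommGroup M] [Module Λ M] [AddCommGroup N] [Module Λ N] (e : M ≃ₗ[Λ] N)
    (h : HasProjInjCopresentation Λ N) : HasProjInjCopresentation Λ M := by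
  obtain ⟨I₀, I₁, f, g, h0, h1, hf, hfg⟩ := h
  refine ⟨I₀, I₁, f ∘ₗ e.toLinearMap, g, h0, h1, hf.comp e.injective, ?_⟩
  exact exact_mkQ_comp e.toLinearMap e.surjective f g hfg

theorem finite_projective_injective_pi {Λ : Type u} [Ring Λ] {ι : Type} [Fintype ι]
    (N : ι → ModuleCat.{u} Λ)
    (h : ∀ i, Module.Finite Λ (N i) ∧ Module.Projective Λ (N i) ∧ Module.Injective Λ (N i)) :
    Module.Finite Λ (∀ i, N i) ∧ Module.Projective Λ (∀ i, N i) ∧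
      Module.Injective Λ (∀ i, N i) := by
  classical
  have h1 := fun i => (h i).1
  have h2 := fun i => (h i).2.1
  have h3 := fun i => (h i).2.2
  exact ⟨inferInstance,
    Module.Projective.of_equiv (DFinsupp.linearEquivFunOnFintype (R := Λ) (M := fun i => N i)),
    Module.Injective.pi Λ _⟩

theorem HasProjInjCopresentation.pi {Λ : Type u} [Ring Λ] {ι : Type} [Fintype ι]
    (N : ι → ModuleCat.{u} Λ) (h : ∀ i, HasProjInjCopresentation Λ (N i)) :
    HasProjInjCopresentation Λ (∀ i, N i) := by
  choose I₀ I₁ f g h0 h1 hf hfg using h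
  refine ⟨ModuleCat.of Λ (∀ i, I₀ i), ModuleCat.of Λ (∀ i, I₁ i),
    LinearMap.pi fun i => f i ∘ₗ LinearMap.proj i, LinearMap.pi fun i => g i ∘ₗ LinearMap.proj i,
    finite_projective_injective_pi I₀ h0, finite_projective_injective_pi I₁ h1,
    fun x y hxy => funext fun i => hf i (congrFun hxy i), fun x => ?_⟩
  constructor
  · intro hx
    choose y hy using fun i => (hfg i (x i)).1 (congrFun hx i)
    exact ⟨y, funext hy⟩
  · rintro ⟨y, rfl⟩
    exact funext fun i => (hfg i).apply_apply_eq_zero (y i)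

/-! ### Injectivity, socles and copresentations in terms of the sequence `c`. -/

namespace CyclicLabelling

variable {Λ : Type u} [Ring Λ] {n : ℕ} (L : CyclicLabelling Λ n)

theorem length_ker_add_one (i : ZMod n) :
    Module.length Λ (LinearMap.ker (L.cover i)) + 1 = Module.length Λ (L.P i) := by
  rw [← length_of_covBy (covBy_top_iff.2 (L.isCoatom_ker _ (L.cover_surjective i))),
    Module.length_top]

/-- If `P i` embeds into `P (i + 1)` as the radical, the embedding does not split. -/
theorem not_retract {i : ZMod n} {f : L.P i →ₗ[Λ] L.P (i + 1)}
    (hf : LinearMap.range f = LinearMap.ker (L.cover (i + 1)))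
    (r : L.P (i + 1) →ₗ[Λ] L.P i) (hr : ∀ x, r (f x) = x) : False := by
  have := L.nontrivial i
  have h := (L.isIndecomposable (i + 1)).surjective_of_retract f r hr
  exact (L.isCoatom_ker _ (L.cover_surjective (i + 1))).1 (hf ▸ LinearMap.range_eq_top.2 h)

/-- An indecomposable projective module with a simple quotient `S j` is isomorphic to `P j`. -/
theorem nonempty_equiv_of_surjective {E : Type u} [AddCommGroup E] [Module Λ E]
    (hE : IsIndecomposable Λ E) [Module.Projective Λ E] {j : ZMod n} (φ : E →ₗ[Λ] L.S j)
    (hφ : Function.Surjective φ) : Nonempty (E ≃ₗ[Λ] L.P j) := by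
  obtain ⟨q, hq⟩ := Module.projective_lifting_property (L.cover j) φ (L.cover_surjective j)
  have hq' : Function.Surjective q := by
    rw [← LinearMap.range_eq_top]
    refine (L.isProjectiveCover j).superfluous _ ((Submodule.eq_top_iff').2 fun x => ?_)
    obtain ⟨y, hy⟩ := hφ (L.cover j x)
    refine Submodule.mem_sup.2 ⟨q y, ⟨y, rfl⟩, x - q y, ?_, by abel⟩
    rw [LinearMap.mem_ker, map_sub, sub_eq_zero, ← hy]
    exact (LinearMap.congr_fun hq y).symm
  have := L.projective j
  have := L.nontrivial j
  obtain ⟨s, hs⟩ := Module.projective_lifting_property q LinearMap.id hq'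
  have hs' : ∀ x, q (s x) = x := LinearMap.congr_fun hs
  exact ⟨(LinearEquiv.ofBijective s ⟨Function.LeftInverse.injective hs',
    hE.surjective_of_retract s q hs'⟩).symm⟩

variable [IsArtinianRing Λ]

theorem exists_equiv_of_projective {E : Type u} [AddCommGroup E] [Module Λ E]
    [Module.Finite Λ E] (hE : IsIndecomposable Λ E) [Module.Projective Λ E] :
    ∃ j, Nonempty (E ≃ₗ[Λ] L.P j) := by
  have := ((isIndecomposable_iff E).1 hE).1
  obtain ⟨A, hA⟩ := exists_covBy_of_wellFoundedGT (α := Submodule Λ E) (a := ⊤)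
    (by rw [isMin_iff_eq_bot]; exact top_ne_bot)
  obtain ⟨j, φ, hφ, -⟩ := L.exists_surjective hA
  exact ⟨j, L.nonempty_equiv_of_surjective hE (φ ∘ₗ Submodule.topEquiv.symm.toLinearMap)
    (hφ.comp (LinearEquiv.surjective _))⟩

/-- The indecomposable projective-injective modules form a finite set of isomorphism classes. -/
theorem exists_isProjInjSum [NeZero n] (L : CyclicLabelling Λ n) (hnak : IsNakayama Λ) :
    ∃ Q : ModuleCat.{u} Λ, IsProjInjSum Λ Q := by
  classical
  let I := {i : ZMod n // Module.Injective Λ (L.P i)}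
  have : Fintype I := Fintype.ofFinite _
  let E := Fintype.equivFin I
  refine ⟨ModuleCat.of Λ (∀ a : Fin (Fintype.card I), L.P (E.symm a).1), _,
    fun a => L.P (E.symm a).1, fun a => ⟨L.finite _, L.isIndecomposable _, L.projective _,
      (E.symm a).2⟩, fun a b ⟨e⟩ => ?_, fun M hM => ?_, ⟨.refl _ _⟩⟩
  · refine E.symm.injective (Subtype.ext ?_)
    exact L.eq_of_surjective (L.isUniserial hnak _) (L.cover _) (L.cover _ ∘ₗ e.toLinearMap)
      (L.cover_surjective _) ((L.cover_surjective _).comp e.surjective)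
  · have := hM.finite
    have := hM.projective
    obtain ⟨j, ⟨e⟩⟩ := L.exists_equiv_of_projective hM.indecomposable
    have hj : Module.Injective Λ (L.P j) := injective_of_linearEquiv e hM.injective
    refine ⟨E ⟨j, hj⟩, ?_⟩
    beta_reduce
    rw [Equiv.symm_apply_apply]
    exact ⟨e⟩

/-- The top of the radical of `P i`, if nonzero, is `S (i - 1)`. -/
theorem exists_surjective_radical (hnak : IsNakayama Λ) {i x : ZMod n} (hx : x = i - 1)
    (h : LinearMap.ker (L.cover i) ≠ ⊥) :
    ∃ ψ : LinearMap.ker (L.cover i) →ₗ[Λ] L.S x, Function.Surjective ψ := by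
  have := L.finite i
  obtain ⟨A, hA⟩ := exists_covBy_of_wellFoundedGT (mt isMin_iff_eq_bot.1 h)
  obtain ⟨ψ, hψ, -⟩ := L.exists_factor hnak i 1 A _ hA
    (by exact_mod_cast L.length_ker_add_one i) x (by simpa using hx)
  exact ⟨ψ, hψ⟩

/-- The radical of `P (i + 1)` has top `S i`, so `P i` maps onto it and `c (i + 1) - 1 ≤ c i`. With
`c i < c (i + 1)` the lengths agree and the surjection is an isomorphism. -/
theorem exists_radical_embedding (hnak : IsNakayama Λ) {c : ZMod n → ℕ}
    (hc : ∀ i, Module.length Λ (L.P i) = (c i : ℕ∞)) {i : ZMod n} (h : c i < c (i + 1)) :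
    c (i + 1) = c i + 1 ∧ ∃ f : L.P i →ₗ[Λ] L.P (i + 1), Function.Injective f ∧
      LinearMap.range f = LinearMap.ker (L.cover (i + 1)) := by
  have hlen := L.length_ker_add_one (i + 1)
  have hpos := L.length_pos hc i
  rw [hc] at hlen
  obtain ⟨b, hb⟩ := ENat.ne_top_iff_exists.1 (ne_top_of_le_ne_top
    (ENat.natCast_ne_top (c (i + 1))) (le_self_add.trans hlen.le))
  rw [← hb] at hlen
  norm_cast at hlen
  have hne : LinearMap.ker (L.cover (i + 1)) ≠ ⊥ := by
    intro h0
    have h1 := (Module.length_eq_zero_iff (R := Λ)).2 (Submodule.subsingleton_iff_eq_bot.2 h0)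
    rw [← hb] at h1
    norm_cast at h1
    omega
  obtain ⟨ψ, hψ⟩ := L.exists_surjective_radical hnak (x := i) (by ring) hne
  obtain ⟨q, hq, -⟩ := L.exists_lift ((L.isUniserial hnak (i + 1)).submodule _) ψ hψ
  have hle := Module.length_le_of_surjective q hq
  rw [← hb, hc i] at hle
  norm_cast at hle
  refine ⟨by omega, (LinearMap.ker (L.cover (i + 1))).subtype ∘ₗ q,
    (Submodule.subtype_injective _).comp
      (injective_of_surjective_of_length_le q hq (hc i).le ?_), ?_⟩
  · rw [← hb]
    exact_mod_cast (by omega : c i ≤ b)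
  · rw [LinearMap.range_comp_of_range_eq_top _ (LinearMap.range_eq_top.2 hq),
      Submodule.range_subtype]

theorem not_injective (hnak : IsNakayama Λ) {c : ZMod n → ℕ}
    (hc : ∀ i, Module.length Λ (L.P i) = (c i : ℕ∞)) {i : ZMod n} (h : c i < c (i + 1)) :
    ¬ Module.Injective Λ (L.P i) := by
  intro hinj
  obtain ⟨-, f, hf, hfr⟩ := L.exists_radical_embedding hnak hc h
  obtain ⟨r, hr⟩ := Module.Injective.out (Q := L.P i) f hf LinearMap.id
  exact L.not_retract hfr r hr

/-- The socle of `P j` is `S (j - c j + 1)`. -/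
theorem nonempty_equiv_of_atom (hnak : IsNakayama Λ) {c : ZMod n → ℕ}
    (hc : ∀ i, Module.length Λ (L.P i) = (c i : ℕ∞)) (j : ZMod n) {B : Submodule Λ (L.P j)}
    (hB : ⊥ ⋖ B) {x : ZMod n} (hx : x = j - c j + 1) : Nonempty (B ≃ₗ[Λ] L.S x) := by
  have hpos := L.length_pos hc j
  -- The socle lies `c j - 1` steps below the top; `hpos` makes the natural subtraction exact.
  obtain ⟨ψ, hψ, hk⟩ := L.exists_factor hnak j (c j - 1) ⊥ B hB (by
    rw [length_of_covBy hB, hc, Module.length_bot]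
    norm_cast
    omega) x (by rw [hx, Nat.cast_sub hpos]; push_cast; ring)
  refine ⟨LinearEquiv.ofBijective ψ ⟨?_, hψ⟩⟩
  rw [← LinearMap.ker_eq_bot, Submodule.eq_bot_iff]
  exact fun b hb => Subtype.ext ((Submodule.mem_bot Λ).1 ((hk b).1 hb))

theorem exists_atom (j : ZMod n) : ∃ B : Submodule Λ (L.P j), ⊥ ⋖ B := by
  have := L.finite j
  have := L.nontrivial j
  exact exists_covBy_of_wellFoundedLT (by rw [isMax_iff_eq_top]; exact bot_ne_top)

theorem exists_socle_embedding (hnak : IsNakayama Λ) {c : ZMod n → ℕ}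
    (hc : ∀ i, Module.length Λ (L.P i) = (c i : ℕ∞)) (j : ZMod n) {x : ZMod n}
    (hx : x = j - c j + 1) : ∃ s : L.S x →ₗ[Λ] L.P j, Function.Injective s := by
  obtain ⟨B, hB⟩ := L.exists_atom j
  obtain ⟨e⟩ := L.nonempty_equiv_of_atom hnak hc j hB hx
  exact ⟨B.subtype ∘ₗ e.symm.toLinearMap, B.subtype_injective.comp e.symm.injective⟩

theorem eq_of_embedding (hnak : IsNakayama Λ) {c : ZMod n → ℕ}
    (hc : ∀ i, Module.length Λ (L.P i) = (c i : ℕ∞)) {j x : ZMod n}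
    (s : L.S x →ₗ[Λ] L.P j) (hs : Function.Injective s) : x = j - c j + 1 := by
  have := L.simple x
  have := IsSimpleModule.congr (LinearEquiv.ofInjective s hs).symm
  have hatom : ⊥ ⋖ LinearMap.range s := bot_covBy_iff.2 (isSimpleModule_iff_isAtom.1 this)
  obtain ⟨e⟩ := L.nonempty_equiv_of_atom hnak hc j hatom rfl
  exact L.distinct _ _ ⟨LinearEquiv.ofInjective s hs ≪≫ₗ e⟩

/-- The injective envelope `E` of `P i` is uniserial and strictly larger. The submodule `M` just
above `P i` is covered by some `P k`, whose radical maps onto `P i`. This splits by projectivity,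
and the radical is indecomposable, so it is isomorphic to `P i`; comparing tops gives `k = i + 1`.
-/
theorem length_eq_of_not_injective {Z : Type u} [CommRing Z] [IsArtinianRing Z] [Algebra Z Λ]
    [Module.Finite Z Λ] (hnak : IsNakayama Λ) {c : ZMod n → ℕ}
    (hc : ∀ i, Module.length Λ (L.P i) = (c i : ℕ∞)) {i : ZMod n}
    (hi : ¬ Module.Injective Λ (L.P i)) : c (i + 1) = c i + 1 := by
  have hu := L.isUniserial hnak i
  have := L.nontrivial i
  obtain ⟨B₀, hB₀⟩ := L.exists_atom i
  obtain ⟨b, hb, hb0⟩ := (Submodule.ne_bot_iff _).1 hB₀.lt.ne'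
  -- The Nakayama hypothesis covers only finitely generated injectives, so the envelope is cut out
  -- of a finitely generated `X`. The element `b` of the socle lies in every nonzero submodule by
  -- uniseriality.
  obtain ⟨X, f, _, _, hf⟩ := exists_finite_injective_of_mem (Z := Z) b hb0 fun N hN => by
    rcases hu N B₀ with h | h
    · exact ((bot_covBy_iff.1 hB₀).le_iff_eq hN).1 h ▸ hb
    · exact h hb
  obtain ⟨E, ι, j, p, hι, hess, hE, hp, -⟩ := exists_envelope f hf
  have hEfin : Module.Finite Λ E := Module.Finite.of_surjective p (Function.LeftInverse.surjective hp)
  have hEu : IsUniserial Λ E := hnak.injective_uniserial E hEfin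
    (isIndecomposable_of_essential hu ι hι hess) hE
  have htop : LinearMap.range ι ≠ ⊤ := fun h => hi <| injective_of_linearEquiv
    (LinearEquiv.ofBijective ι ⟨hι, LinearMap.range_eq_top.1 h⟩).symm hE
  obtain ⟨M, hM⟩ := exists_covBy_of_wellFoundedLT (mt isMax_iff_eq_top.1 htop)
  obtain ⟨k, φ, hφ, hφk⟩ := L.exists_surjective hM
  obtain ⟨q, hq, hq'⟩ := L.exists_lift (hEu.submodule M) φ hφ
  let e := LinearEquiv.ofInjective ι hι
  let B := LinearMap.ker (L.cover k)
  have hqB : ∀ x : B, (q x : E) ∈ LinearMap.range ι := fun x => (hφk _).1 (by rw [hq']; exact x.2)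
  let q₀ : B →ₗ[Λ] LinearMap.range ι :=
    (M.subtype ∘ₗ q ∘ₗ B.subtype).codRestrict (LinearMap.range ι) hqB
  have hq₀ : Function.Surjective q₀ := fun y => by
    obtain ⟨x, hx⟩ := hq ⟨y, hM.le y.2⟩
    have hxB : x ∈ B := by
      rw [LinearMap.mem_ker, ← hq', hφk, hx]
      exact y.2
    have hxy : (q x : E) = y := congrArg Subtype.val hx
    exact ⟨⟨x, hxB⟩, Subtype.ext hxy⟩
  let r : B →ₗ[Λ] L.P i := e.symm.toLinearMap ∘ₗ q₀
  have hr : Function.Surjective r := e.symm.surjective.comp hq₀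
  have := L.projective i
  obtain ⟨s, hs⟩ := Module.projective_lifting_property r LinearMap.id hr
  have hs' : ∀ x, r (s x) = x := LinearMap.congr_fun hs
  have hBnt : Nontrivial B := hr.nontrivial
  have hBu : IsUniserial Λ B := (L.isUniserial hnak k).submodule B
  have hsb : Function.Bijective s := ⟨Function.LeftInverse.injective hs',
    hBu.isIndecomposable.surjective_of_retract s r hs'⟩
  have hlen := L.length_ker_add_one k
  rw [← (LinearEquiv.ofBijective s hsb).length_eq, hc, hc] at hlen
  obtain ⟨ψ, hψ⟩ := L.exists_surjective_radical hnak (x := k - 1) rfl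
    (Submodule.nontrivial_iff_ne_bot.1 hBnt)
  have hik : i = k - 1 := L.eq_of_surjective hBu (L.cover i ∘ₗ r) ψ
    ((L.cover_surjective i).comp hr) hψ
  have hk : k = i + 1 := by rw [hik]; ring
  rw [← hk]
  exact_mod_cast hlen.symm

/-- Climbing `P i ⊂ P (i + 1) ⊂ …` raises the length by one while the module is not injective, so it
stops within the maximum of `c`. -/
theorem exists_embedding_injective {Z : Type u} [CommRing Z] [IsArtinianRing Z] [Algebra Z Λ]
    [Module.Finite Z Λ] [NeZero n] (hnak : IsNakayama Λ) {c : ZMod n → ℕ}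
    (hc : ∀ i, Module.length Λ (L.P i) = (c i : ℕ∞)) (i : ZMod n) :
    ∃ (j : ZMod n) (e : L.P i →ₗ[Λ] L.P j), Module.Injective Λ (L.P j) ∧ Function.Injective e := by
  suffices h : ∀ (d : ℕ) (i : ZMod n), Finset.univ.sup c ≤ c i + d →
      ∃ (j : ZMod n) (e : L.P i →ₗ[Λ] L.P j), Module.Injective Λ (L.P j) ∧ Function.Injective e from
    h _ i le_add_self
  intro d
  induction d with
  | zero =>
    intro i hi
    by_cases hinj : Module.Injective Λ (L.P i)
    · exact ⟨i, LinearMap.id, hinj, fun _ _ h => h⟩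
    · have h1 := L.length_eq_of_not_injective (Z := Z) hnak hc hinj
      have h2 := Finset.le_sup (f := c) (Finset.mem_univ (i + 1))
      omega
  | succ d ih =>
    intro i hi
    by_cases hinj : Module.Injective Λ (L.P i)
    · exact ⟨i, LinearMap.id, hinj, fun _ _ h => h⟩
    · have h1 := L.length_eq_of_not_injective (Z := Z) hnak hc hinj
      obtain ⟨-, f, hf, -⟩ := L.exists_radical_embedding hnak hc (i := i) (by omega)
      obtain ⟨j, e, hj, he⟩ := ih (i + 1) (by omega)
      exact ⟨j, e ∘ₗ f, hj, he.comp hf⟩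

theorem hasProjInjCopresentation_P {Z : Type u} [CommRing Z] [IsArtinianRing Z] [Algebra Z Λ]
    [Module.Finite Z Λ] [NeZero n] (hnak : IsNakayama Λ) {c : ZMod n → ℕ}
    (hc : ∀ i, Module.length Λ (L.P i) = (c i : ℕ∞))
    (h : setP c ⊆ {i : ZMod n | ∃ j ∈ setQ c, i = j - (c j : ZMod n)}) (i : ZMod n) :
    HasProjInjCopresentation Λ (L.P i) := by
  by_cases hinj : Module.Injective Λ (L.P i)
  · exact ⟨L.P i, L.P i, LinearMap.id, 0, ⟨L.finite i, L.projective i, hinj⟩,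
      ⟨L.finite i, L.projective i, hinj⟩, fun _ _ h => h, fun x => by simp⟩
  · have h1 := L.length_eq_of_not_injective (Z := Z) hnak hc hinj
    obtain ⟨j, hjQ, hj⟩ := h h1
    have hjinj : Module.Injective Λ (L.P j) := by
      by_contra hj'
      have h2 := L.length_eq_of_not_injective (Z := Z) hnak hc hj'
      have h3 : c (j + 1) ≤ c j := hjQ
      omega
    obtain ⟨-, f, hf, hfr⟩ := L.exists_radical_embedding hnak hc (i := i) (by omega)
    obtain ⟨k, e, hk, he⟩ := L.exists_embedding_injective (Z := Z) hnak hc (i + 1)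
    obtain ⟨s, hs⟩ := L.exists_socle_embedding hnak hc j (x := i + 1) (by rw [hj])
    -- `g` extends `P (i + 1) → S (i + 1) → P j` to the injective module `P k`; its kernel should be
    -- the copy of `P i`.
    obtain ⟨g, hg⟩ := Module.Injective.out (Q := L.P j) e he (s ∘ₗ L.cover (i + 1))
    refine ⟨L.P k, L.P j, e ∘ₗ f, g, ⟨L.finite k, L.projective k, hk⟩,
      ⟨L.finite j, L.projective j, hjinj⟩, he.comp hf, fun x => ⟨fun hx => ?_, ?_⟩⟩
    -- By uniseriality the alternative is that `g` kills all of `P (i + 1)`, yet there it is the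
    -- nonzero map `s ∘ L.cover (i + 1)`.
    · have hle : LinearMap.ker g ≤ LinearMap.range e := by
        refine (L.isUniserial hnak k _ _).resolve_right fun hle => ?_
        have := L.simple_nontrivial (i + 1)
        obtain ⟨t, ht⟩ := exists_ne (0 : L.S (i + 1))
        obtain ⟨y, rfl⟩ := L.cover_surjective (i + 1) t
        refine ht (hs ?_)
        rw [map_zero]
        exact (hg y).symm.trans (hle ⟨y, rfl⟩)
      obtain ⟨y, rfl⟩ := hle hx
      rw [hg, LinearMap.comp_apply, map_eq_zero_iff s hs] at hx
      obtain ⟨z, rfl⟩ : y ∈ LinearMap.range f := hfr ▸ hx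
      exact ⟨z, rfl⟩
    · rintro ⟨z, rfl⟩
      have hz : f z ∈ LinearMap.ker (L.cover (i + 1)) := hfr ▸ ⟨z, rfl⟩
      rw [LinearMap.comp_apply, hg, LinearMap.comp_apply, LinearMap.mem_ker.1 hz, map_zero]

theorem hasProjInjCopresentation_of_subset {Z : Type u} [CommRing Z] [IsArtinianRing Z]
    [Algebra Z Λ] [Module.Finite Z Λ] [NeZero n] (hnak : IsNakayama Λ) {c : ZMod n → ℕ}
    (hc : ∀ i, Module.length Λ (L.P i) = (c i : ℕ∞))
    (h : setP c ⊆ {i : ZMod n | ∃ j ∈ setQ c, i = j - (c j : ZMod n)}) :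
    HasProjInjCopresentation Λ Λ := by
  classical
  obtain ⟨ι, _, N, hN, ⟨e⟩⟩ := exists_decomposition (Λ := Λ) Λ
  refine (HasProjInjCopresentation.pi N fun i => ?_).of_linearEquiv e
  let j : N i →ₗ[Λ] Λ := e.symm.toLinearMap ∘ₗ LinearMap.single Λ (fun i => (N i : Type u)) i
  let p : Λ →ₗ[Λ] N i := LinearMap.proj i ∘ₗ e.toLinearMap
  have hp : ∀ x, p (j x) = x := fun x => by simp [p, j]
  have : Module.Finite Λ (N i) :=
    Module.Finite.of_surjective p (Function.LeftInverse.surjective hp)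
  have : Module.Projective Λ (N i) := Module.Projective.of_split j p (LinearMap.ext hp)
  obtain ⟨k, ⟨e'⟩⟩ := L.exists_equiv_of_projective (hN i)
  exact (L.hasProjInjCopresentation_P (Z := Z) hnak hc h k).of_linearEquiv e'

/-- The inclusion of `P i` into `I₀` extends to `h` on `P (i + 1)`, and `g ∘ h` embeds `P (i + 1) /
P i = S (i + 1)` into `I₁`. The envelope of `S (i + 1)` is then a summand of `I₁`, hence an
injective `P j` with socle `S (i + 1)`. -/
theorem subset_of_hasProjInjCopresentation (hnak : IsNakayama Λ) {c : ZMod n → ℕ}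
    (hc : ∀ i, Module.length Λ (L.P i) = (c i : ℕ∞)) (h : HasProjInjCopresentation Λ Λ) :
    setP c ⊆ {i : ZMod n | ∃ j ∈ setQ c, i = j - (c j : ZMod n)} := by
  obtain ⟨I₀, I₁, f, g, ⟨-, -, i0⟩, ⟨f1, p1, i1⟩, hf, hfg⟩ := h
  intro i hi
  have hci : c (i + 1) = c i + 1 := hi
  obtain ⟨-, w, hw, hwr⟩ := L.exists_radical_embedding hnak hc (i := i) (by omega)
  obtain ⟨s, r, hrs⟩ := L.exists_retract i
  obtain ⟨h, hh⟩ := Module.Injective.out (Q := I₀) w hw (f ∘ₗ s)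
  have hker : LinearMap.ker (g ∘ₗ h) = LinearMap.ker (L.cover (i + 1)) := by
    have hm := L.isCoatom_ker _ (L.cover_surjective (i + 1))
    have hle : LinearMap.ker (L.cover (i + 1)) ≤ LinearMap.ker (g ∘ₗ h) := by
      rw [← hwr]
      rintro _ ⟨x, rfl⟩
      rw [LinearMap.mem_ker, LinearMap.comp_apply, hh]
      exact hfg.apply_apply_eq_zero _
    -- If `g ∘ h` vanished, `h` would factor through `Λ`, and composing with `r` would split `P i`
    -- off `P (i + 1)`.
    refine (hm.le_iff.1 hle).resolve_left fun htop => ?_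
    have hmem : ∀ x, h x ∈ LinearMap.range f := fun x =>
      (hfg _).1 (htop ▸ Submodule.mem_top : x ∈ LinearMap.ker (g ∘ₗ h))
    let e := LinearEquiv.ofInjective f hf
    let h' : L.P (i + 1) →ₗ[Λ] Λ := e.symm.toLinearMap ∘ₗ h.codRestrict (LinearMap.range f) hmem
    refine L.not_retract hwr (r ∘ₗ h') fun x => ?_
    have : h' (w x) = s x := by
      rw [LinearMap.comp_apply, LinearEquiv.coe_coe, LinearEquiv.symm_apply_eq]
      exact Subtype.ext (hh x)
    rw [LinearMap.comp_apply, this, hrs]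
  have hS := L.simple (i + 1)
  have := L.simple_nontrivial (i + 1)
  let E₁ := (L.cover (i + 1)).quotKerEquivOfSurjective (L.cover_surjective (i + 1))
  let σ : L.S (i + 1) →ₗ[Λ] I₁ :=
    (LinearMap.ker (L.cover (i + 1))).liftQ (g ∘ₗ h) hker.ge ∘ₗ E₁.symm.toLinearMap
  have hσ : Function.Injective σ :=
    (LinearMap.ker_eq_bot.1 (Submodule.ker_liftQ_eq_bot _ _ hker.ge hker.le)).comp E₁.symm.injective
  obtain ⟨E, ι, a, p, hι, hess, hE, hp, -⟩ := exists_envelope σ hσ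
  have : Module.Finite Λ E := Module.Finite.of_surjective p (Function.LeftInverse.surjective hp)
  have : Module.Projective Λ E := Module.Projective.of_split a p (LinearMap.ext hp)
  obtain ⟨j, ⟨e⟩⟩ := L.exists_equiv_of_projective
    (isIndecomposable_of_essential isUniserial_of_isSimpleModule ι hι hess)
  have hj : Module.Injective Λ (L.P j) := injective_of_linearEquiv e hE
  refine ⟨j, not_lt.1 fun hlt => L.not_injective hnak hc hlt hj, ?_⟩
  have := L.eq_of_embedding hnak hc (e.toLinearMap ∘ₗ ι) (e.injective.comp hι)
  exact add_right_cancel this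

end CyclicLabelling

end NakayamaTilting

theorem mainTheorem10
    {R : Type v} [CommRing R] [IsArtinianRing R]
    {Λ : Type u} [Ring Λ] [Algebra R Λ] [Module.Finite R Λ]
    (hbasic : NakayamaTilting.IsBasicAlgebra Λ)
    (hconn : NakayamaTilting.IsConnectedAlgebra Λ)
    (hnak : NakayamaTilting.IsNakayama Λ)
    (n : ℕ) [NeZero n] (L : NakayamaTilting.CyclicLabelling Λ n)
    (c : ZMod n → ℕ) (hc : ∀ i, Module.length Λ (L.P i) = (c i : ℕ∞)) :
    (2 ≤ NakayamaTilting.domDim Λ Λ ↔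
      NakayamaTilting.setP c ⊆
        {i : ZMod n | ∃ j ∈ NakayamaTilting.setQ c, i = j - (c j : ZMod n)}) ∧
    (2 ≤ NakayamaTilting.domDim Λ Λ ↔
      ∃ T : ModuleCat.{u} Λ,
        NakayamaTilting.IsTilting Λ T ∧ NakayamaTilting.InSubcategoryC Λ T) := by
  have : IsArtinianRing Λ := IsArtinianRing.of_finite R Λ
  -- The centre serves as base ring because it lives in the universe of `Λ`, as the coinduced
  -- modules require; `R` may not.
  obtain ⟨_, _⟩ := NakayamaTilting.center_artinian (R := R) Λ
  rw [NakayamaTilting.two_le_domDim_iff]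
  refine ⟨⟨L.subset_of_hasProjInjCopresentation hnak hc,
    L.hasProjInjCopresentation_of_subset (Z := Subring.center Λ) hnak hc⟩, fun h => ?_,
    NakayamaTilting.hasProjInjCopresentation_of_exists_tilting⟩
  obtain ⟨Q, hQ⟩ := L.exists_isProjInjSum hnak
  exact NakayamaTilting.exists_tilting_of_hasProjInjCopresentation hQ h
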